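/- Let $d \ge 2$ and let $S \subset \mathbb{R}^d$ be a finite set with $|S|$ even. Alice chooses a point $a \in \mathbb{R}^d$; then Bob, knowing $a$, chooses a point $b \in \mathbb{R}^d$. Each $y \in S$ votes for the candidate strictly closer to it in Euclidean distance, and for nobody in case of a tie. A point $a$ is a \emph{winning point} for Alice if for every $b$ Alice gets at least as many votes as Bob, and \emph{Alice wins} if she has a winning point. A hyperplane $H = \{y : \langle y, c\rangle = \lambda\}$ ($c \ne 0$) is \emph{perfect} if each of the open half-spaces $\{\langle y,c\rangle > \lambda\}$ and $\{\langle y,c\rangle < \lambda\}$ contains fewer than $|S|/2$ points of $S$. For a line $l$ through a point $x$, let $l^+$ and $l^-$ be the two open half-lines into which $x$ divides $l$; $l$ is \emph{balanced} about $x$ if $\bigl||l^+\cap S| - |l^-\cap S|\bigr| \le 1$, and \emph{odd-balanced} about $x$ if moreover $|(l\setminus\{x\})\cap S|$ is odd. For $x \in \mathbb{R}^d$ consider the conditions: (i) Every perfect hyperplane contains $x$. (ii) Every line through $x$ is balanced about $x$, and there is a plane $P$ that contains all the odd-balanced lines about $x$. If there are no odd-balanced lines about $x$, then $x \notin S$.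 If there is at least one odd-balanced line about $x$, then $x \in S$, the number $k$ of odd-balanced lines is odd, and, whenever these lines are labelled $l_1,\dots,l_k$ in rotational order on $P$, so that their half-lines appear around $x$ in the order $l_1^+,\dots,l_k^+,l_1^-,\dots,l_k^-$, either $|l_i^+\cap S| = |l_i^-\cap S|+1$ precisely when $i$ is odd, or $|l_i^+\cap S| = |l_i^-\cap S|+1$ precisely when $i$ is even. Then Alice wins if and only if some $x \in \mathbb{R}^d$ satisfies (i), and also if and only if some $x \in \mathbb{R}^d$ satisfies (ii). Every $x$ satisfying (ii) satisfies (i) and is a winning point for Alice. If the points of $S$ do not all lie on a single line, then for every $x \in \mathbb{R}^d$ conditions (i) and (ii) are equivalent, and every $x$ satisfying (i) is a winning point for Alice. -/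

import Mathlib

open scoped RealInnerProductSpace

/-- The number of votes of the candidate at `p` against the candidate at `q`: the number of voters
in `S` that are strictly closer to `p` than to `q`. -/
noncomputable def voteCount {d : ℕ} (S : Finset (EuclideanSpace ℝ (Fin d)))
    (p q : EuclideanSpace ℝ (Fin d)) : ℕ :=
  {y : EuclideanSpace ℝ (Fin d) | y ∈ S ∧ dist p y < dist q y}.ncard

/-- `a` is a winning point for Alice: whatever Bob answers, Alice gets at least as many votes. -/
def IsWinningPoint {d : ℕ} (S : Finset (EuclideanSpace ℝ (Fin d)))
    (a : EuclideanSpace ℝ (Fin d)) : Prop :=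
  ∀ b : EuclideanSpace ℝ (Fin d), voteCount S b a ≤ voteCount S a b

/-- Alice wins: she moves first and has a winning point. -/
def AliceWins {d : ℕ} (S : Finset (EuclideanSpace ℝ (Fin d))) : Prop :=
  ∃ a : EuclideanSpace ℝ (Fin d), IsWinningPoint S a

/-- The number of points of `S` that lie in the set `A`. -/
noncomputable def countIn {d : ℕ} (S : Finset (EuclideanSpace ℝ (Fin d)))
    (A : Set (EuclideanSpace ℝ (Fin d))) : ℕ :=
  (A ∩ (S : Set (EuclideanSpace ℝ (Fin d)))).ncard

/-- For a set `S` of even size: `H` is a hyperplane `⟪y, c⟫ = r` with `c ≠ 0`, and each of the two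
open half-spaces that it defines contains fewer than half of the points of `S`. -/
def IsPerfectHyperplane {d : ℕ} (S : Finset (EuclideanSpace ℝ (Fin d)))
    (H : Set (EuclideanSpace ℝ (Fin d))) : Prop :=
  ∃ (c : EuclideanSpace ℝ (Fin d)) (r : ℝ), c ≠ 0 ∧ H = {y | ⟪y, c⟫ = r} ∧
    (countIn S {y | ⟪y, c⟫ > r} : ℝ) < (S.card : ℝ) / 2 ∧
    (countIn S {y | ⟪y, c⟫ < r} : ℝ) < (S.card : ℝ) / 2

/-- The open half-line from `x` (not containing `x`) in the direction `v`, for `v ≠ 0`. -/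
def openHalfLine {d : ℕ} (x v : EuclideanSpace ℝ (Fin d)) : Set (EuclideanSpace ℝ (Fin d)) :=
  {y | ∃ t : ℝ, 0 < t ∧ y = x + t • v}

/-- `l` is a line through `x`. -/
def IsLineThrough {d : ℕ} (x : EuclideanSpace ℝ (Fin d))
    (l : AffineSubspace ℝ (EuclideanSpace ℝ (Fin d))) : Prop :=
  x ∈ l ∧ Module.finrank ℝ l.direction = 1

/-- The line `l` through `x` is balanced about `x`: the numbers of points of `S` on the two open
half-lines of `l` at `x` differ by at most one. (The condition is the same for every nonzero
direction vector `v` of `l`.) -/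
def IsBalancedLine {d : ℕ} (S : Finset (EuclideanSpace ℝ (Fin d))) (x : EuclideanSpace ℝ (Fin d))
    (l : AffineSubspace ℝ (EuclideanSpace ℝ (Fin d))) : Prop :=
  IsLineThrough x l ∧ ∀ v ∈ l.direction, v ≠ 0 →
    |(countIn S (openHalfLine x v) : ℤ) - (countIn S (openHalfLine x (-v)) : ℤ)| ≤ 1

/-- `l` is balanced about `x` and contains an odd number of points of `S` other than `x`. -/
def IsOddBalancedLine {d : ℕ} (S : Finset (EuclideanSpace ℝ (Fin d)))
    (x : EuclideanSpace ℝ (Fin d)) (l : AffineSubspace ℝ (EuclideanSpace ℝ (Fin d))) : Prop :=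
  IsBalancedLine S x l ∧
    Odd (countIn S ((l : Set (EuclideanSpace ℝ (Fin d))) \ {x}))

/-- The set of all odd-balanced lines about `x`. -/
def oddBalancedLines {d : ℕ} (S : Finset (EuclideanSpace ℝ (Fin d)))
    (x : EuclideanSpace ℝ (Fin d)) : Set (AffineSubspace ℝ (EuclideanSpace ℝ (Fin d))) :=
  {l | IsOddBalancedLine S x l}

/-- The vectors `v 0, …, v (k - 1)` list the odd-balanced lines about `x` in rotational order on the
plane `P`: these lines are the lines through `x` in the directions `v i`, and, with
`l i ⁺ = openHalfLine x (v i)` and `l i ⁻ = openHalfLine x (-v i)`, the half-lines appear, when one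
turns about `x` on `P` in one sense, in the order `l 0 ⁺, …, l (k - 1) ⁺, l 0 ⁻, …, l (k - 1) ⁻`.
The vectors `e`, `f` fix a sense of rotation on `P`, and `θ i` is the polar angle of `v i`. -/
def IsRotationalLabelling {d : ℕ} (S : Finset (EuclideanSpace ℝ (Fin d)))
    (x : EuclideanSpace ℝ (Fin d)) (P : AffineSubspace ℝ (EuclideanSpace ℝ (Fin d)))
    (k : ℕ) (v : Fin k → EuclideanSpace ℝ (Fin d)) : Prop :=
  Set.range (fun i => AffineSubspace.mk' x (Submodule.span ℝ {v i})) = oddBalancedLines S x ∧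
  ∃ e ∈ P.direction, ∃ f ∈ P.direction, ‖e‖ = 1 ∧ ‖f‖ = 1 ∧ ⟪e, f⟫ = 0 ∧
    ∃ θ : Fin k → ℝ, StrictMono θ ∧ (∀ i j, θ j < θ i + Real.pi) ∧
      ∀ i, v i = Real.cos (θ i) • e + Real.sin (θ i) • f

/-- The extra points alternate: `|l i ⁺ ∩ S| = |l i ⁻ ∩ S| + 1` precisely for the odd labels, or
precisely for the even labels. The labels are `1, …, k`, so the label of `i : Fin k` is `i + 1`. -/
def ExtraPointsAlternate {d : ℕ} (S : Finset (EuclideanSpace ℝ (Fin d)))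
    (x : EuclideanSpace ℝ (Fin d)) (k : ℕ) (v : Fin k → EuclideanSpace ℝ (Fin d)) : Prop :=
  (∀ i : Fin k, countIn S (openHalfLine x (v i)) = countIn S (openHalfLine x (-v i)) + 1 ↔
    Odd ((i : ℕ) + 1)) ∨
  (∀ i : Fin k, countIn S (openHalfLine x (v i)) = countIn S (openHalfLine x (-v i)) + 1 ↔
    Even ((i : ℕ) + 1))

/-- Every perfect hyperplane contains `x`. -/
def PerfectHyperplanesContain {d : ℕ} (S : Finset (EuclideanSpace ℝ (Fin d)))
    (x : EuclideanSpace ℝ (Fin d)) : Prop :=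
  ∀ H : Set (EuclideanSpace ℝ (Fin d)), IsPerfectHyperplane S H → x ∈ H

/-- Every line through `x` is balanced about `x`; some plane `P` contains all the odd-balanced lines
about `x`; if there are none, then `x ∉ S`; if there is one, then `x ∈ S`, the number of
odd-balanced lines is odd, and in rotational order on `P` their extra points alternate. -/
def BalancedLinesCondition {d : ℕ} (S : Finset (EuclideanSpace ℝ (Fin d)))
    (x : EuclideanSpace ℝ (Fin d)) : Prop :=
  (∀ l : AffineSubspace ℝ (EuclideanSpace ℝ (Fin d)), IsLineThrough x l → IsBalancedLine S x l) ∧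
  ∃ P : AffineSubspace ℝ (EuclideanSpace ℝ (Fin d)), Module.finrank ℝ P.direction = 2 ∧
    (∀ l ∈ oddBalancedLines S x, l ≤ P) ∧
    (oddBalancedLines S x = ∅ → x ∉ S) ∧
    ((oddBalancedLines S x).Nonempty →
      x ∈ S ∧ Odd (oddBalancedLines S x).ncard ∧
      ∀ (k : ℕ) (v : Fin k → EuclideanSpace ℝ (Fin d)),
        IsRotationalLabelling S x P k v → ExtraPointsAlternate S x k v)

/-! Put the origin at `x`, let `A` be the translate of `S`, and for a vector `c` let the sign sum be
the number of points of `A` on the positive side of `cᗮ` minus the number on the negative side.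
Bob's best replies lie very close to `x`, so `x` wins exactly when no open half-space bounded by a
hyperplane through `x` has more than half of the voters. Equivalently, all sign sums are at most 1
in absolute value, and all vanish if `x ∉ S`.

Condition (i). A perfect hyperplane missing a winning point would leave too many voters on one side
of that point. Conversely, if (i) holds but some half-space at `x` is too heavy, order `A` by its
normal. The upper half of `A` must stay separated from the lower half as the normal turns, since
otherwise a perfect hyperplane missing `x` appears. This rigidity forces `A` onto a line through the
origin (`exists_forall_mem_span_of_lt_two_mul_card`). For collinear `S` a median voter wins.

Condition (ii). Perturbing `c` shows that a bound on all sign sums is inherited by the part of `A`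
in any subspace (`abs_signSum_filter_mem_le`). On lines this gives balance. Opposite points then
cancel, and only one unit vector per odd-balanced line, pointing to its heavier side, contributes
(`signSum_oddDirections`). On a plane containing just two of these vectors `u`, `v`, the sign sum at
`u + v` would be 2. So each plane through two of them contains a third, and the projective
Sylvester–Gallai theorem puts them all in one plane. There the vectors become weights `±1` along an
arc shorter than a half turn, and sign sums are at most 1 exactly when the weights alternate
(`abs_sum_weight_mul_sign_le_one`, `weight_eq_of_abs_sum_le_one`). Parity supplies the odd number of
lines. -/

/-! ### Sign sums and their perturbation. -/

section SignSums

variable {E : Type*} [NormedAddCommGroup E] [InnerProductSpace ℝ E]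

/-- The number of vectors of `A` on the positive side of `cᗮ` minus the number on the negative
side. -/
noncomputable def signSum (A : Finset E) (c : E) : ℤ :=
  ∑ a ∈ A, (SignType.sign ⟪a, c⟫ : ℤ)

theorem signSum_neg (A : Finset E) (c : E) : signSum A (-c) = -signSum A c := by
  simp [signSum, inner_neg_right, Left.sign_neg]

/-- Nonzero signs survive a small perturbation, and where the inner product with `c` vanishes the
perturbing vector decides. -/
theorem eventually_sign_add_smul (a c w : E) :
    ∀ᶠ ε : ℝ in nhdsWithin 0 (Set.Ioi 0), SignType.sign ⟪a, c + ε • w⟫ =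
      if ⟪a, c⟫ = 0 then SignType.sign ⟪a, w⟫ else SignType.sign ⟪a, c⟫ := by
  have hcont : Continuous fun ε : ℝ => ⟪a, c + ε • w⟫ := by fun_prop
  have hlim : Filter.Tendsto (fun ε : ℝ => ⟪a, c + ε • w⟫) (nhdsWithin 0 (Set.Ioi 0))
      (nhds ⟪a, c⟫) := by
    have := (hcont.tendsto 0).mono_left (nhdsWithin_le_nhds (s := Set.Ioi (0 : ℝ)))
    simpa using this
  rcases lt_trichotomy ⟪a, c⟫ 0 with h | h | h
  · filter_upwards [hlim.eventually_lt_const h] with ε hε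
    rw [if_neg h.ne, sign_neg hε, sign_neg h]
  · filter_upwards [self_mem_nhdsWithin] with ε hε
    rw [if_pos h, inner_add_right, h, zero_add, inner_smul_right, sign_mul,
      sign_pos (Set.mem_Ioi.1 hε), one_mul]
  · filter_upwards [hlim.eventually_const_lt h] with ε hε
    rw [if_neg h.ne', sign_pos hε, sign_pos h]

theorem exists_sign_add_smul (A : Finset E) (c w : E) :
    ∃ ε : ℝ, 0 < ε ∧ ∀ a ∈ A, SignType.sign ⟪a, c + ε • w⟫ =
      if ⟪a, c⟫ = 0 then SignType.sign ⟪a, w⟫ else SignType.sign ⟪a, c⟫ := by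
  have h : ∀ᶠ ε : ℝ in nhdsWithin 0 (Set.Ioi 0), ∀ a ∈ A, SignType.sign ⟪a, c + ε • w⟫ =
      if ⟪a, c⟫ = 0 then SignType.sign ⟪a, w⟫ else SignType.sign ⟪a, c⟫ :=
    (Filter.eventually_all_finset A).2 fun a _ => eventually_sign_add_smul a c w
  obtain ⟨ε, h1, h2⟩ := (h.and self_mem_nhdsWithin).exists
  exact ⟨ε, h2, h1⟩

theorem signSum_eq_of_sign (A : Finset E) (c w c' : E)
    (h : ∀ a ∈ A, SignType.sign ⟪a, c'⟫ =
      if ⟪a, c⟫ = 0 then SignType.sign ⟪a, w⟫ else SignType.sign ⟪a, c⟫) :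
    signSum A c' = signSum A c + signSum (A.filter fun a => ⟪a, c⟫ = 0) w := by
  unfold signSum
  rw [Finset.sum_filter, ← Finset.sum_add_distrib]
  refine Finset.sum_congr rfl fun a ha => ?_
  rw [h a ha]
  by_cases h0 : ⟪a, c⟫ = 0 <;> simp [h0]

/-- A finite set that avoids a subspace is avoided by the orthogonal complement of some vector
orthogonal to that subspace. -/
theorem exists_mem_orthogonal_inner_ne_zero (Q : Submodule ℝ E) [Q.HasOrthogonalProjection]
    (A : Finset E) (hA : ∀ a ∈ A, a ∉ Q) : ∃ c ∈ Qᗮ, ∀ a ∈ A, ⟪a, c⟫ ≠ 0 := by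
  classical
  induction A using Finset.induction_on with
  | empty => exact ⟨0, Submodule.zero_mem _, by simp⟩
  | insert b A hb ih =>
    obtain ⟨c, hc, hcA⟩ := ih fun a ha => hA a (Finset.mem_insert_of_mem ha)
    have hbQ : b ∉ Qᗮᗮ := by
      rw [Submodule.orthogonal_orthogonal]
      exact hA b (Finset.mem_insert_self _ _)
    obtain ⟨w, hw, hbw⟩ : ∃ w ∈ Qᗮ, ⟪b, w⟫ ≠ 0 := by
      by_contra! h
      exact hbQ ((Submodule.mem_orthogonal' _ _).2 h)
    obtain ⟨ε, -, hs⟩ := exists_sign_add_smul (insert b A) c w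
    refine ⟨c + ε • w, Submodule.add_mem _ hc (Submodule.smul_mem _ _ hw), fun a ha => ?_⟩
    rw [← sign_ne_zero, hs a ha]
    split_ifs with h0
    · rcases Finset.mem_insert.1 ha with rfl | ha
      · exact sign_ne_zero.2 hbw
      · exact absurd h0 (hcA a ha)
    · exact sign_ne_zero.2 h0

theorem exists_inner_ne_zero (A : Finset E) : ∃ c : E, ∀ a ∈ A, a ≠ 0 → ⟪a, c⟫ ≠ 0 := by
  classical
  obtain ⟨c, -, hc⟩ := exists_mem_orthogonal_inner_ne_zero (⊥ : Submodule ℝ E) (A.erase 0)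
    (by intro a ha; simpa using Finset.ne_of_mem_erase ha)
  exact ⟨c, fun a ha h0 => hc a (Finset.mem_erase.2 ⟨h0, ha⟩)⟩

open scoped Classical in
/-- A bound for the sign sums passes to the part of the set that lies in a subspace. -/
theorem abs_signSum_filter_mem_le {A : Finset E} {δ : ℤ} (h : ∀ c, |signSum A c| ≤ δ)
    (Q : Submodule ℝ E) [Q.HasOrthogonalProjection] (w : E) :
    |signSum (A.filter (· ∈ Q)) w| ≤ δ := by
  obtain ⟨c, hc, hcA⟩ := exists_mem_orthogonal_inner_ne_zero Q (A.filter (· ∉ Q))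
    (by intro a ha; exact (Finset.mem_filter.1 ha).2)
  have hfilter : (A.filter fun a => ⟪a, c⟫ = 0) = A.filter (· ∈ Q) := by
    refine Finset.filter_congr fun a ha => ⟨fun h0 => ?_, fun hQ => ?_⟩
    · by_contra hQ
      exact hcA a (Finset.mem_filter.2 ⟨ha, hQ⟩) h0
    · exact (Submodule.mem_orthogonal _ _).1 hc a hQ
  -- Perturbing by `w` and by `-w` gives sign sums `s + t` and `s - t`, where `t` is the
  -- contribution of `Q`. If both are at most `δ` in absolute value, so is `t`.
  obtain ⟨ε, -, h1⟩ := exists_sign_add_smul A c w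
  obtain ⟨ε', -, h2⟩ := exists_sign_add_smul A c (-w)
  have e1 := signSum_eq_of_sign A c w _ h1
  have e2 := signSum_eq_of_sign A c (-w) _ h2
  rw [hfilter] at e1 e2
  rw [signSum_neg] at e2
  have b1 := h (c + ε • w)
  have b2 := h (c + ε' • -w)
  rw [e1] at b1
  rw [e2] at b2
  rw [abs_le] at *
  omega

/-- A bound for the sign sums at the vectors orthogonal to no nonzero element holds everywhere. -/
theorem abs_signSum_le_of_generic {A : Finset E} {δ : ℤ}
    (h : ∀ c, (∀ a ∈ A, a ≠ 0 → ⟪a, c⟫ ≠ 0) → |signSum A c| ≤ δ) (c : E) :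
    |signSum A c| ≤ δ := by
  -- Both perturbations of `c` by `±w` are generic, and the sign sum at `c` is the mean of theirs.
  obtain ⟨w, hw⟩ := exists_inner_ne_zero A
  obtain ⟨ε, -, h1⟩ := exists_sign_add_smul A c w
  obtain ⟨ε', -, h2⟩ := exists_sign_add_smul A c (-w)
  have e1 := signSum_eq_of_sign A c w _ h1
  have e2 := signSum_eq_of_sign A c (-w) _ h2
  rw [signSum_neg] at e2
  have b1 := h (c + ε • w) fun a ha h0 => by
    rw [← sign_ne_zero, h1 a ha]
    split_ifs with h'
    exacts [sign_ne_zero.2 (hw a ha h0), sign_ne_zero.2 h']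
  have b2 := h (c + ε' • -w) fun a ha h0 => by
    rw [← sign_ne_zero, h2 a ha]
    split_ifs with h'
    · rw [inner_neg_right]
      exact sign_ne_zero.2 (neg_ne_zero.2 (hw a ha h0))
    · exact sign_ne_zero.2 h'
  rw [e1] at b1
  rw [e2] at b2
  rw [abs_le] at *
  omega

theorem signSum_eq_card_sub_card (A : Finset E) (c : E) :
    signSum A c = ((A.filter fun a => 0 < ⟪a, c⟫).card : ℤ) -
      (A.filter fun a => ⟪a, c⟫ < 0).card := by
  simp only [signSum, Finset.card_filter, Nat.cast_sum]
  rw [← Finset.sum_sub_distrib]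
  refine Finset.sum_congr rfl fun a _ => ?_
  rcases lt_trichotomy ⟪a, c⟫ 0 with h | h | h
  · simp [h, h.not_gt]
  · simp [h]
  · simp [h, h.not_gt]

theorem card_eq_card_pos_add_card_neg_add_card_zero (A : Finset E) (c : E) :
    A.card = (A.filter fun a => 0 < ⟪a, c⟫).card + (A.filter fun a => ⟪a, c⟫ < 0).card +
      (A.filter fun a => ⟪a, c⟫ = 0).card := by
  simp only [Finset.card_filter, Finset.card_eq_sum_ones A]
  rw [← Finset.sum_add_distrib, ← Finset.sum_add_distrib]
  refine Finset.sum_congr rfl fun a _ => ?_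
  rcases lt_trichotomy ⟪a, c⟫ 0 with h | h | h
  · simp [h, h.ne, h.not_gt]
  · simp [h]
  · simp [h, h.ne', h.not_gt]

open scoped Classical in
theorem filter_inner_eq_zero_of_generic {A : Finset E} {c : E}
    (hc : ∀ a ∈ A, a ≠ 0 → ⟪a, c⟫ ≠ 0) :
    (A.filter fun a => ⟪a, c⟫ = 0).card = if (0 : E) ∈ A then 1 else 0 := by
  have : (A.filter fun a => ⟪a, c⟫ = 0) = A.filter (· = 0) := by
    refine Finset.filter_congr fun a ha => ⟨fun h => ?_, fun h => by simp [h]⟩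
    by_contra h0
    exact hc a ha h0 h
  rw [this]
  split_ifs with h0
  · rw [Finset.card_eq_one]
    exact ⟨0, by ext a; simp only [Finset.mem_filter, Finset.mem_singleton]; aesop⟩
  · rw [Finset.card_eq_zero, Finset.filter_eq_empty_iff]
    rintro a ha rfl
    exact h0 ha

open scoped Classical in
/-- All open half-spaces bounded by hyperplanes through the origin contain at most half of the
points exactly when the sign sums are as small as possible. -/
theorem forall_two_mul_card_pos_le_iff (A : Finset E) :
    (∀ c, 2 * (A.filter fun a => 0 < ⟪a, c⟫).card ≤ A.card) ↔
      ∀ c, |signSum A c| ≤ if (0 : E) ∈ A then 1 else 0 := by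
  constructor
  · intro h
    -- For generic `c` only the origin can lie on the hyperplane, so the positive and negative
    -- counts add up to `A.card` or `A.card - 1`.
    refine abs_signSum_le_of_generic fun c hc => ?_
    have h1 := h c
    have h2 := h (-c)
    simp only [inner_neg_right, Left.neg_pos_iff] at h2
    have h3 := card_eq_card_pos_add_card_neg_add_card_zero A c
    rw [filter_inner_eq_zero_of_generic hc] at h3
    rw [signSum_eq_card_sub_card, abs_le]
    split_ifs at h3 ⊢ <;> omega
  · intro h c
    have h1 := h c
    have h3 := card_eq_card_pos_add_card_neg_add_card_zero A c
    rw [signSum_eq_card_sub_card, abs_le] at h1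
    split_ifs at h1 with h0
    · have : 0 < (A.filter fun a => ⟪a, c⟫ = 0).card :=
        Finset.card_pos.2 ⟨0, Finset.mem_filter.2 ⟨h0, by simp⟩⟩
      omega
    · omega

end SignSums

/-! ### Order statistics. -/

section Median

/-- The `k`-th largest value of a function on a finite set. -/
theorem exists_kth_largest {α : Type*} (A : Finset α) (f : α → ℝ) {k : ℕ} (hk : 0 < k)
    (hkA : k ≤ A.card) :
    ∃ b ∈ A, k ≤ (A.filter fun a => f b ≤ f a).card ∧ (A.filter fun a => f b < f a).card < k := by
  have hA : A.Nonempty := Finset.card_pos.1 (hk.trans_le hkA)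
  obtain ⟨m, hm, hmin⟩ := A.exists_min_image f hA
  have hR : (A.filter fun b => k ≤ (A.filter fun a => f b ≤ f a).card).Nonempty := by
    refine ⟨m, Finset.mem_filter.2 ⟨hm, ?_⟩⟩
    rwa [Finset.filter_true_of_mem fun a ha => hmin a ha]
  -- Take the largest value that at least `k` elements reach. If `k` elements exceeded it, the
  -- smallest among those would be a larger such value.
  obtain ⟨b, hb, hmax⟩ := Finset.exists_max_image _ f hR
  rw [Finset.mem_filter] at hb
  refine ⟨b, hb.1, hb.2, ?_⟩
  by_contra! hlt
  obtain ⟨a, ha, hamin⟩ := Finset.exists_min_image _ f (Finset.card_pos.1 (hk.trans_le hlt))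
  rw [Finset.mem_filter] at ha
  refine (hmax a (Finset.mem_filter.2 ⟨ha.1, hlt.trans (Finset.card_le_card ?_)⟩)).not_gt ha.2
  intro y hy
  exact Finset.mem_filter.2 ⟨(Finset.mem_filter.1 hy).1, hamin y hy⟩

theorem card_filter_lt_add_card_filter_le {α : Type*} (A : Finset α) (f : α → ℝ) (r : ℝ) :
    (A.filter fun a => f a < r).card + (A.filter fun a => r ≤ f a).card = A.card := by
  have := Finset.card_filter_add_card_filter_not (s := A) (fun a => f a < r)
  simpa only [not_lt] using this

end Median

/-! ### Rotating a perfect hyperplane. -/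

section CommonPoint

variable {E : Type*} [NormedAddCommGroup E] [InnerProductSpace ℝ E]

/-- If the open half-space of `b` lies in that of `z`, then `z` is a multiple of `b`. -/
theorem mem_span_singleton_of_inner_pos {b z c₀ : E} (hc₀ : 0 < ⟪b, c₀⟫)
    (h : ∀ c, 0 < ⟪b, c⟫ → 0 < ⟪z, c⟫) : z ∈ Submodule.span ℝ {b} := by
  rw [← Submodule.orthogonal_orthogonal (Submodule.span ℝ {b}), Submodule.mem_orthogonal']
  intro w hw
  rw [Submodule.mem_orthogonal_singleton_iff_inner_right] at hw
  by_contra hne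
  -- Moving along `w` keeps the inner product with `b`; the coefficient makes the one with `z` zero.
  have := h (c₀ + (-⟪z, c₀⟫ / ⟪z, w⟫) • w) (by
    rw [inner_add_right, inner_smul_right, hw]; simpa using hc₀)
  rw [inner_add_right, inner_smul_right, div_mul_cancel₀ _ hne] at this
  simp at this

/-- If all hyperplanes that leave fewer than half of the points of `A` strictly on each side contain
the origin, then a hyperplane through the origin with more than half of the points on one side
exists only if `A` lies on a line through the origin. -/
theorem exists_forall_mem_span_of_lt_two_mul_card {A : Finset E} (hA : Even A.card)
    (h : ∀ (c : E) (r : ℝ), c ≠ 0 → 2 * (A.filter fun a => r < ⟪a, c⟫).card < A.card →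
      2 * (A.filter fun a => ⟪a, c⟫ < r).card < A.card → r = 0)
    {c₀ : E} (hc₀ : A.card < 2 * (A.filter fun a => 0 < ⟪a, c₀⟫).card) :
    ∃ b : E, ∀ a ∈ A, a ∈ Submodule.span ℝ {b} := by
  classical
  obtain ⟨n, hn⟩ := hA
  have hle := Finset.card_filter_le A fun a => 0 < ⟪a, c₀⟫
  -- With `2n` points, rank `n + 1` leaves at most `n` points strictly above `b` and at most `n - 1`
  -- strictly below. Unless exactly `n` lie above, the level of `b` is a perfect hyperplane missing
  -- the origin.
  obtain ⟨b, hbA, hb1, hb2⟩ :=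
    exists_kth_largest A (fun a => ⟪a, c₀⟫) (k := n + 1) (by omega) (by omega)
  have hr : 0 < ⟪b, c₀⟫ := by
    by_contra! hr
    have : (A.filter fun a => 0 < ⟪a, c₀⟫).card ≤ (A.filter fun a => ⟪b, c₀⟫ < ⟪a, c₀⟫).card :=
      Finset.card_le_card (Finset.monotone_filter_right _ fun a _ ha => hr.trans_lt ha)
    omega
  have hcount := card_filter_lt_add_card_filter_le A (fun a => ⟪a, c₀⟫) ⟪b, c₀⟫
  beta_reduce at hcount
  have hc₀ne : c₀ ≠ 0 := by rintro rfl; simp at hr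
  set T := A.filter fun a => ⟪b, c₀⟫ < ⟪a, c₀⟫ with hT
  set B := A.filter fun a => ¬ ⟪b, c₀⟫ < ⟪a, c₀⟫ with hB
  have hTcard : T.card = n := by
    by_contra hne
    have hlt : 2 * T.card < A.card := by omega
    exact hr.ne' (h c₀ ⟪b, c₀⟫ hc₀ne hlt (by omega))
  have hTB : T.card + B.card = A.card := Finset.card_filter_add_card_filter_not _
  have hTne : T.Nonempty := Finset.card_pos.1 (by omega)
  have hbB : b ∈ B := Finset.mem_filter.2 ⟨hbA, lt_irrefl _⟩
  have hBne : B.Nonempty := ⟨b, hbB⟩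
  -- The separation of `T` from `B` persists for every normal positive on `b`. This confines the
  -- differences `t - b'` to the line of `b`.
  have key : ∀ c, 0 < ⟪b, c⟫ → ∀ t ∈ T, ∀ b' ∈ B, 0 < ⟪t - b', c⟫ := by
    intro c hc
    let γ : ℝ → E := fun s => (1 - s) • c₀ + s • c
    -- The gap between the lowest point of `T` and the highest point of `B` along the turning
    -- normal.
    let g : ℝ → ℝ := fun s => T.inf' hTne (fun t => ⟪t, γ s⟫) - B.sup' hBne fun t => ⟪t, γ s⟫
    have hγ : ∀ s ∈ Set.Icc (0 : ℝ) 1, 0 < ⟪b, γ s⟫ := by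
      intro s hs
      simp only [γ, inner_add_right, inner_smul_right]
      rcases hs.1.eq_or_lt with rfl | hs0
      · simpa using hr
      · exact add_pos_of_nonneg_of_pos (mul_nonneg (sub_nonneg.2 hs.2) hr.le) (mul_pos hs0 hc)
    have hg : Continuous g := by
      refine Continuous.sub ?_ ?_
      · exact Continuous.finset_inf'_apply hTne fun t _ => by fun_prop
      · exact Continuous.finset_sup'_apply hBne fun t _ => by fun_prop
    have hg0 : 0 < g 0 := by
      have e : γ 0 = c₀ := by simp [γ]
      simp only [g, e, sub_pos]
      refine lt_of_le_of_lt (b := ⟪b, c₀⟫) ?_ ?_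
      · exact Finset.sup'_le _ _ fun t ht => not_lt.1 (Finset.mem_filter.1 ht).2
      · exact (Finset.lt_inf'_iff _).2 fun t ht => (Finset.mem_filter.1 ht).2
    have hg1 : 0 < g 1 := by
      by_contra! hg1
      -- When the gap closes, the common level contains a point of `T` and a point of `B`, so each
      -- side has at most `n - 1` points. The level is at least that of `b`, hence positive, so this
      -- perfect hyperplane misses the origin.
      obtain ⟨s, hs, hgs⟩ := intermediate_value_Icc' zero_le_one hg.continuousOn ⟨hg1, hg0.le⟩
      have hpos := hγ s hs
      obtain ⟨t₀, ht₀, et₀⟩ := T.exists_mem_eq_inf' hTne fun t => ⟪t, γ s⟫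
      obtain ⟨b₀, hb₀, eb₀⟩ := B.exists_mem_eq_sup' hBne fun t => ⟪t, γ s⟫
      have hle : ⟪b, γ s⟫ ≤ B.sup' hBne fun t => ⟪t, γ s⟫ :=
        Finset.le_sup' (fun t => ⟪t, γ s⟫) hbB
      have heq : (T.inf' hTne fun t => ⟪t, γ s⟫) = B.sup' hBne fun t => ⟪t, γ s⟫ :=
        sub_eq_zero.1 hgs
      refine (hpos.trans_le hle).ne' (h (γ s) _ ?_ ?_ ?_)
      · intro e
        simp [e] at hpos
      · have hsub : (A.filter fun a => (B.sup' hBne fun t => ⟪t, γ s⟫) < ⟪a, γ s⟫) ⊆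
            T.erase t₀ := by
          intro a ha
          rw [Finset.mem_filter] at ha
          refine Finset.mem_erase.2 ⟨?_, ?_⟩
          · rintro rfl
            rw [← heq, et₀] at ha
            exact lt_irrefl _ ha.2
          · by_contra haT
            have : a ∈ B := Finset.mem_filter.2
              ⟨ha.1, fun hlt => haT (Finset.mem_filter.2 ⟨ha.1, hlt⟩)⟩
            exact ha.2.not_ge (Finset.le_sup' (fun t => ⟪t, γ s⟫) this)
        have := Finset.card_le_card hsub
        rw [Finset.card_erase_of_mem ht₀] at this
        omega
      · have hsub : (A.filter fun a => ⟪a, γ s⟫ < B.sup' hBne fun t => ⟪t, γ s⟫) ⊆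
            B.erase b₀ := by
          intro a ha
          rw [Finset.mem_filter] at ha
          refine Finset.mem_erase.2 ⟨?_, ?_⟩
          · rintro rfl
            rw [eb₀] at ha
            exact lt_irrefl _ ha.2
          · refine Finset.mem_filter.2 ⟨ha.1, fun hlt => ?_⟩
            have haT : a ∈ T := Finset.mem_filter.2 ⟨ha.1, hlt⟩
            rw [← heq] at ha
            exact ha.2.not_ge (Finset.inf'_le (fun t => ⟪t, γ s⟫) haT)
        have := Finset.card_le_card hsub
        rw [Finset.card_erase_of_mem hb₀] at this
        omega
    intro t ht b' hb'
    have e : γ 1 = c := by simp [γ]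
    simp only [g, e] at hg1
    rw [inner_sub_left]
    have h1 : (T.inf' hTne fun t => ⟪t, c⟫) ≤ ⟪t, c⟫ := Finset.inf'_le (fun t => ⟪t, c⟫) ht
    have h2 : ⟪b', c⟫ ≤ B.sup' hBne fun t => ⟪t, c⟫ := Finset.le_sup' (fun t => ⟪t, c⟫) hb'
    linarith
  have hspan : ∀ t ∈ T, ∀ b' ∈ B, t - b' ∈ Submodule.span ℝ {b} := fun t ht b' hb' =>
    mem_span_singleton_of_inner_pos hr fun c hc => key c hc t ht b' hb'
  have hbs : b ∈ Submodule.span ℝ {b} := Submodule.mem_span_singleton_self b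
  have hTs : ∀ t ∈ T, t ∈ Submodule.span ℝ {b} := fun t ht => by
    simpa using Submodule.add_mem _ (hspan t ht b hbB) hbs
  refine ⟨b, fun a ha => ?_⟩
  by_cases haT : a ∈ T
  · exact hTs a haT
  · have haB : a ∈ B := Finset.mem_filter.2
      ⟨ha, fun hlt => haT (Finset.mem_filter.2 ⟨ha, hlt⟩)⟩
    obtain ⟨t, ht⟩ := hTne
    simpa using Submodule.sub_mem _ (hTs t ht) (hspan t ht a haB)

end CommonPoint

/-! ### Votes as half-space counts. -/

section Votes

variable {d : ℕ}

/-- The points of `S` as seen from `x`. -/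
def centered (S : Finset (EuclideanSpace ℝ (Fin d))) (x : EuclideanSpace ℝ (Fin d)) :
    Finset (EuclideanSpace ℝ (Fin d)) :=
  S.map (Equiv.subRight x).toEmbedding

theorem card_centered (S : Finset (EuclideanSpace ℝ (Fin d))) (x : EuclideanSpace ℝ (Fin d)) :
    (centered S x).card = S.card :=
  Finset.card_map _

theorem mem_centered {S : Finset (EuclideanSpace ℝ (Fin d))} {x a : EuclideanSpace ℝ (Fin d)} :
    a ∈ centered S x ↔ x + a ∈ S := by
  simp only [centered, Finset.mem_map_equiv]
  simp [add_comm]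

theorem zero_mem_centered {S : Finset (EuclideanSpace ℝ (Fin d))}
    {x : EuclideanSpace ℝ (Fin d)} : 0 ∈ centered S x ↔ x ∈ S := by
  simp [mem_centered]

theorem card_filter_centered (S : Finset (EuclideanSpace ℝ (Fin d)))
    (x : EuclideanSpace ℝ (Fin d)) (p : EuclideanSpace ℝ (Fin d) → Prop) [DecidablePred p] :
    ((centered S x).filter p).card = (S.filter fun y => p (y - x)).card := by
  rw [centered, Finset.filter_map, Finset.card_map]
  rfl

theorem countIn_eq_card_filter (S : Finset (EuclideanSpace ℝ (Fin d)))
    (p : EuclideanSpace ℝ (Fin d) → Prop) [DecidablePred p] :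
    countIn S {y | p y} = (S.filter p).card := by
  rw [countIn, ← Set.ncard_coe_finset]
  congr 1
  ext y
  simp [and_comm]

theorem voteCount_eq_card_filter (S : Finset (EuclideanSpace ℝ (Fin d)))
    (p q : EuclideanSpace ℝ (Fin d)) :
    voteCount S p q = (S.filter fun y => dist p y < dist q y).card := by
  rw [voteCount, ← Set.ncard_coe_finset]
  congr 1
  ext y
  simp

theorem dist_add_lt_dist_iff (x u y : EuclideanSpace ℝ (Fin d)) :
    dist (x + u) y < dist x y ↔ ‖u‖ ^ 2 < 2 * ⟪y - x, u⟫ := by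
  rw [dist_comm, dist_comm x, dist_eq_norm, dist_eq_norm,
    ← sq_lt_sq₀ (norm_nonneg _) (norm_nonneg _), show y - (x + u) = y - x - u by abel,
    norm_sub_sq_real (y - x) u]
  constructor <;> intro h <;> linarith

theorem dist_lt_dist_add_iff (x u y : EuclideanSpace ℝ (Fin d)) :
    dist x y < dist (x + u) y ↔ 2 * ⟪y - x, u⟫ < ‖u‖ ^ 2 := by
  rw [dist_comm, dist_comm (x + u), dist_eq_norm, dist_eq_norm,
    ← sq_lt_sq₀ (norm_nonneg _) (norm_nonneg _), show y - (x + u) = y - x - u by abel,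
    norm_sub_sq_real (y - x) u]
  constructor <;> intro h <;> linarith

/-- Alice's point wins exactly when no open half-space bounded by a hyperplane through it contains
more than half of the voters. -/
theorem isWinningPoint_iff (S : Finset (EuclideanSpace ℝ (Fin d)))
    (x : EuclideanSpace ℝ (Fin d)) :
    IsWinningPoint S x ↔
      ∀ c, 2 * ((centered S x).filter fun a => 0 < ⟪a, c⟫).card ≤ (centered S x).card := by
  simp only [card_filter_centered, card_centered]
  constructor
  · intro h c
    by_cases hc : c = 0
    · simp [hc]
    -- Bob steps so little in direction `c` that he wins every voter strictly on that side.
    obtain ⟨t, ht0, ht⟩ : ∃ t : ℝ, 0 < t ∧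
        ∀ y ∈ S, 0 < ⟪y - x, c⟫ → t * ‖c‖ ^ 2 < 2 * ⟪y - x, c⟫ := by
      have hev : ∀ᶠ t : ℝ in nhdsWithin 0 (Set.Ioi 0),
          ∀ y ∈ S, 0 < ⟪y - x, c⟫ → t * ‖c‖ ^ 2 < 2 * ⟪y - x, c⟫ := by
        refine (Filter.eventually_all_finset S).2 fun y _ => ?_
        by_cases hy : 0 < ⟪y - x, c⟫
        · have hcont : Continuous fun t : ℝ => t * ‖c‖ ^ 2 := by fun_prop
          have hlim := (hcont.tendsto 0).mono_left (nhdsWithin_le_nhds (s := Set.Ioi (0 : ℝ)))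
          rw [zero_mul] at hlim
          filter_upwards [hlim.eventually_lt_const (show (0 : ℝ) < 2 * ⟪y - x, c⟫ by linarith)]
            with t ht _ using ht
        · exact Filter.Eventually.of_forall fun t h' => absurd h' hy
      obtain ⟨t, h1, h2⟩ := (hev.and self_mem_nhdsWithin).exists
      exact ⟨t, h2, h1⟩
    have hb := h (x + t • c)
    rw [voteCount_eq_card_filter, voteCount_eq_card_filter] at hb
    have hnorm : ‖t • c‖ ^ 2 = t * (t * ‖c‖ ^ 2) := by
      rw [norm_smul, Real.norm_of_nonneg ht0.le]; ring
    have h1 : (S.filter fun y => 0 < ⟪y - x, c⟫).card ≤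
        (S.filter fun y => dist (x + t • c) y < dist x y).card := by
      refine Finset.card_le_card fun y hy => ?_
      rw [Finset.mem_filter] at hy ⊢
      refine ⟨hy.1, ?_⟩
      rw [dist_add_lt_dist_iff, hnorm, inner_smul_right]
      have := mul_lt_mul_of_pos_left (ht y hy.1 hy.2) ht0
      linarith
    have h2 : (S.filter fun y => dist x y < dist (x + t • c) y).card ≤
        (S.filter fun y => ¬ 0 < ⟪y - x, c⟫).card := by
      refine Finset.card_le_card fun y hy => ?_
      rw [Finset.mem_filter] at hy ⊢
      refine ⟨hy.1, fun hpos => ?_⟩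
      have hd := hy.2
      rw [dist_lt_dist_add_iff, hnorm, inner_smul_right] at hd
      have := mul_lt_mul_of_pos_left (ht y hy.1 hpos) ht0
      linarith
    have h3 := Finset.card_filter_add_card_filter_not (s := S) fun y => 0 < ⟪y - x, c⟫
    omega
  · intro h b
    obtain ⟨u, rfl⟩ : ∃ u, b = x + u := ⟨b - x, by abel⟩
    by_cases hu : u = 0
    · simp [hu]
    rw [voteCount_eq_card_filter, voteCount_eq_card_filter]
    have hupos : 0 < ‖u‖ ^ 2 := by positivity
    have h1 : (S.filter fun y => dist (x + u) y < dist x y).card ≤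
        (S.filter fun y => 0 < ⟪y - x, u⟫).card := by
      refine Finset.card_le_card (Finset.monotone_filter_right _ fun y _ hy => ?_)
      rw [dist_add_lt_dist_iff] at hy
      show 0 < ⟪y - x, u⟫
      linarith
    have h2 : (S.filter fun y => ¬ 0 < ⟪y - x, u⟫).card ≤
        (S.filter fun y => dist x y < dist (x + u) y).card := by
      refine Finset.card_le_card (Finset.monotone_filter_right _ fun y _ hy => ?_)
      show dist x y < dist (x + u) y
      rw [dist_lt_dist_add_iff]
      linarith [not_lt.1 hy]
    have h3 := Finset.card_filter_add_card_filter_not (s := S) fun y => 0 < ⟪y - x, u⟫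
    have := h u
    omega

theorem isPerfectHyperplane_iff (S : Finset (EuclideanSpace ℝ (Fin d)))
    (H : Set (EuclideanSpace ℝ (Fin d))) :
    IsPerfectHyperplane S H ↔ ∃ (c : EuclideanSpace ℝ (Fin d)) (r : ℝ), c ≠ 0 ∧
      H = {y | ⟪y, c⟫ = r} ∧ 2 * (S.filter fun y => r < ⟪y, c⟫).card < S.card ∧
      2 * (S.filter fun y => ⟪y, c⟫ < r).card < S.card := by
  have key : ∀ m n : ℕ, (m : ℝ) < (n : ℝ) / 2 ↔ 2 * m < n := by
    intro m n
    rw [lt_div_iff₀ two_pos, mul_comm]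
    exact_mod_cast Iff.rfl
  simp only [IsPerfectHyperplane, gt_iff_lt, countIn_eq_card_filter, key]

/-- If a perfect hyperplane misses `x`, the closed half-space on its far side from `x` has more than
half of the voters and lies in an open half-space bounded by a parallel hyperplane through `x`. -/
theorem perfectHyperplanesContain_of_isWinningPoint {S : Finset (EuclideanSpace ℝ (Fin d))}
    {x : EuclideanSpace ℝ (Fin d)} (h : IsWinningPoint S x) : PerfectHyperplanesContain S x := by
  rw [isWinningPoint_iff] at h
  simp only [card_filter_centered, card_centered] at h
  intro H hH
  obtain ⟨c, r, -, rfl, h1, h2⟩ := (isPerfectHyperplane_iff S H).1 hH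
  by_contra hx
  rcases lt_or_gt_of_ne hx with hlt | hlt
  · have h3 := h c
    have h4 := Finset.card_filter_add_card_filter_not (s := S) fun y => ⟪y, c⟫ < r
    have h5 : (S.filter fun y => ¬ ⟪y, c⟫ < r).card ≤ (S.filter fun y => 0 < ⟪y - x, c⟫).card := by
      refine Finset.card_le_card (Finset.monotone_filter_right _ fun y _ hy => ?_)
      show 0 < ⟪y - x, c⟫
      rw [inner_sub_left]
      linarith [not_lt.1 hy]
    omega
  · have h3 := h (-c)
    have h4 := Finset.card_filter_add_card_filter_not (s := S) fun y => r < ⟪y, c⟫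
    have h5 : (S.filter fun y => ¬ r < ⟪y, c⟫).card ≤
        (S.filter fun y => 0 < ⟪y - x, -c⟫).card := by
      refine Finset.card_le_card (Finset.monotone_filter_right _ fun y _ hy => ?_)
      show 0 < ⟪y - x, -c⟫
      rw [inner_neg_right, inner_sub_left]
      linarith [not_lt.1 hy]
    omega

theorem isWinningPoint_of_perfectHyperplanesContain {S : Finset (EuclideanSpace ℝ (Fin d))}
    (hS : Even S.card) (hcol : ¬ Collinear ℝ (S : Set (EuclideanSpace ℝ (Fin d))))
    {x : EuclideanSpace ℝ (Fin d)} (h : PerfectHyperplanesContain S x) : IsWinningPoint S x := by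
  rw [isWinningPoint_iff]
  by_contra! hc
  obtain ⟨c₀, hc₀⟩ := hc
  obtain ⟨b, hb⟩ := exists_forall_mem_span_of_lt_two_mul_card (by rwa [card_centered]) (by
    intro c r hc h1 h2
    rw [card_filter_centered, card_centered] at h1 h2
    simp only [inner_sub_left, lt_sub_iff_add_lt, sub_lt_iff_lt_add] at h1 h2
    have hx : ⟪x, c⟫ = r + ⟪x, c⟫ := h {y | ⟪y, c⟫ = r + ⟪x, c⟫}
      ((isPerfectHyperplane_iff S _).2 ⟨c, _, hc, rfl, h1, h2⟩)
    linarith) hc₀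
  refine hcol ((collinear_iff_exists_forall_eq_smul_vadd _).2 ⟨x, b, fun y hy => ?_⟩)
  obtain ⟨t, ht⟩ := Submodule.mem_span_singleton.1 (hb (y - x) (mem_centered.2 (by simpa using hy)))
  exact ⟨t, by rw [ht]; simp⟩

/-- Take a median in the line parameter. Any hyperplane through it either contains the line or cuts
it into the two sides of the median. -/
theorem exists_isWinningPoint_of_collinear {S : Finset (EuclideanSpace ℝ (Fin d))}
    (hcol : Collinear ℝ (S : Set (EuclideanSpace ℝ (Fin d)))) :
    ∃ x, IsWinningPoint S x := by
  obtain ⟨p, v, hp⟩ := (collinear_iff_exists_forall_eq_smul_vadd _).1 hcol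
  rcases S.eq_empty_or_nonempty with rfl | hne
  · exact ⟨0, (isWinningPoint_iff _ _).2 fun c => by simp [centered]⟩
  choose! τ hτ using hp
  have hpos := Finset.card_pos.2 hne
  obtain ⟨b, -, h1, h2⟩ := exists_kth_largest S τ (k := S.card / 2 + 1) (by omega) (by omega)
  have h3 := card_filter_lt_add_card_filter_le S τ (τ b)
  refine ⟨τ b • v +ᵥ p, (isWinningPoint_iff _ _).2 fun c => ?_⟩
  rw [card_filter_centered, card_centered]
  have hin : ∀ y ∈ S, ⟪y - (τ b • v +ᵥ p), c⟫ = (τ y - τ b) * ⟪v, c⟫ := by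
    intro y hy
    conv_lhs => rw [hτ y hy]
    rw [vadd_eq_add, vadd_eq_add, add_sub_add_right_eq_sub, ← sub_smul, real_inner_smul_left]
  rcases lt_trichotomy ⟪v, c⟫ 0 with hv | hv | hv
  · have : (S.filter fun y => 0 < ⟪y - (τ b • v +ᵥ p), c⟫).card ≤
        (S.filter fun y => τ y < τ b).card := by
      refine Finset.card_le_card fun y hy => ?_
      rw [Finset.mem_filter] at hy ⊢
      rw [hin y hy.1] at hy
      exact ⟨hy.1, by nlinarith [hy.2]⟩
    omega
  · rw [Finset.filter_false_of_mem fun y hy => by rw [hin y hy, hv]; simp]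
    simp
  · have : (S.filter fun y => 0 < ⟪y - (τ b • v +ᵥ p), c⟫).card ≤
        (S.filter fun y => τ b < τ y).card := by
      refine Finset.card_le_card fun y hy => ?_
      rw [Finset.mem_filter] at hy ⊢
      rw [hin y hy.1] at hy
      exact ⟨hy.1, by nlinarith [hy.2]⟩
    omega

end Votes

/-! ### Sylvester–Gallai, affine and projective. -/

section SylvesterGallai

variable {E : Type*} [NormedAddCommGroup E] [InnerProductSpace ℝ E]

/-- The squared distance from `p` to the line through `q` in direction `u`. -/
noncomputable def lineDistSq (p q u : E) : ℝ :=
  ‖p - q‖ ^ 2 - ⟪p - q, u⟫ ^ 2 / ‖u‖ ^ 2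

theorem lineDistSq_eq {q u h : E} (hu : u ≠ 0) (hh : ⟪h, u⟫ = 0) (σ : ℝ) :
    lineDistSq (q + (σ • u + h)) q u = ‖h‖ ^ 2 := by
  have hu' : ‖u‖ ^ 2 ≠ 0 := by positivity
  have hh' : ⟪u, h⟫ = 0 := by rw [real_inner_comm, hh]
  rw [lineDistSq, add_sub_cancel_left, norm_add_sq_real, inner_add_left, inner_smul_left,
    inner_smul_left, hh, hh', real_inner_self_eq_norm_sq, norm_smul, Real.norm_eq_abs, mul_pow,
    sq_abs]
  simp
  field_simp
  ring

/-- Of three distinct reals, two lie on the same side of any given real. -/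
theorem exists_pair_sq_sub_le {α β γ : ℝ} (h₁ : α ≠ β) (h₂ : α ≠ γ) (h₃ : β ≠ γ) (σ : ℝ) :
    ∃ a ∈ ({α, β, γ} : Set ℝ), ∃ b ∈ ({α, β, γ} : Set ℝ), a ≠ b ∧ (a - b) ^ 2 ≤ (σ - b) ^ 2 := by
  have key : ∀ a b : ℝ, 0 ≤ (a - σ) * (b - σ) →
      (a - b) ^ 2 ≤ (σ - b) ^ 2 ∨ (b - a) ^ 2 ≤ (σ - a) ^ 2 := by
    intro a b hab
    rcases le_total ((a - σ) ^ 2) ((b - σ) ^ 2) with h | h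
    · left
      have h1 := mul_le_mul_of_nonneg_left (sq_le_sq.1 h) (abs_nonneg (a - σ))
      rw [abs_mul_abs_self, ← abs_mul, mul_comm (a - σ) (b - σ),
        abs_of_nonneg (by linarith)] at h1
      nlinarith
    · right
      have h1 := mul_le_mul_of_nonneg_left (sq_le_sq.1 h) (abs_nonneg (b - σ))
      rw [abs_mul_abs_self, ← abs_mul, mul_comm (b - σ) (a - σ),
        abs_of_nonneg (by linarith)] at h1
      nlinarith
  have pair : 0 ≤ (α - σ) * (β - σ) ∨ 0 ≤ (α - σ) * (γ - σ) ∨ 0 ≤ (β - σ) * (γ - σ) := by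
    by_contra! h
    have := mul_pos_of_neg_of_neg h.1 h.2.1
    nlinarith [sq_nonneg (α - σ)]
  rcases pair with h | h | h
  · rcases key _ _ h with h | h
    exacts [⟨α, by simp, β, by simp, h₁, h⟩, ⟨β, by simp, α, by simp, h₁.symm, h⟩]
  · rcases key _ _ h with h | h
    exacts [⟨α, by simp, γ, by simp, h₂, h⟩, ⟨γ, by simp, α, by simp, h₂.symm, h⟩]
  · rcases key _ _ h with h | h
    exacts [⟨β, by simp, γ, by simp, h₃, h⟩, ⟨γ, by simp, β, by simp, h₃.symm, h⟩]

/-- The **Sylvester–Gallai theorem**: if the line through any two points of a finite set contains a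
third point of the set, then the set lies on a line. -/
theorem sylvester_gallai (V : Finset E)
    (hV : ∀ p ∈ V, ∀ q ∈ V, p ≠ q → ∃ t : ℝ, t ≠ 0 ∧ t ≠ 1 ∧ p + t • (q - p) ∈ V)
    {p q r : E} (hp : p ∈ V) (hq : q ∈ V) (hr : r ∈ V) (hqr : q ≠ r) :
    ∃ t : ℝ, p = q + t • (r - q) := by
  classical
  by_contra! hne
  let bad := (V ×ˢ V ×ˢ V).filter fun z =>
    z.2.1 ≠ z.2.2 ∧ ∀ t : ℝ, z.1 ≠ z.2.1 + t • (z.2.2 - z.2.1)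
  have hbad : bad.Nonempty := ⟨(p, q, r), by simp [bad, hp, hq, hr, hqr, hne]⟩
  -- Kelly's argument: take a point off a line spanned by the set, at minimal distance.
  obtain ⟨⟨p, q, r⟩, hmem, hmin⟩ :=
    bad.exists_min_image (fun z => lineDistSq z.1 z.2.1 (z.2.2 - z.2.1)) hbad
  simp only [bad, Finset.mem_filter, Finset.mem_product] at hmem
  obtain ⟨⟨hp, hq, hr⟩, hqr, hline⟩ := hmem
  obtain ⟨τ, hτ0, hτ1, hτ⟩ := hV q hq r hr hqr
  obtain ⟨u, rfl⟩ : ∃ u, r = q + u := ⟨r - q, by abel⟩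
  simp only [add_sub_cancel_left] at *
  have hu : u ≠ 0 := by rintro rfl; simp at hqr
  have hu' : ‖u‖ ^ 2 ≠ 0 := by positivity
  obtain ⟨σ, hσ⟩ : ∃ σ, σ = ⟪p - q, u⟫ / ‖u‖ ^ 2 := ⟨_, rfl⟩
  obtain ⟨h, hh⟩ : ∃ h, h = p - q - σ • u := ⟨_, rfl⟩
  have hhu : ⟪h, u⟫ = 0 := by
    rw [hh, inner_sub_left, inner_smul_left, real_inner_self_eq_norm_sq, hσ]
    simp
    field_simp
    ring
  have huh : ⟪u, h⟫ = 0 := by rw [real_inner_comm, hhu]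
  have hpe : p = q + (σ • u + h) := by rw [hh]; abel
  clear hσ hh
  subst hpe
  have hh0 : h ≠ 0 := by
    rintro rfl
    exact hline σ (by simp)
  have hmemV : ∀ a ∈ ({0, 1, τ} : Set ℝ), q + a • u ∈ V := by
    rintro a (rfl | rfl | rfl)
    · simpa using hq
    · simpa using hr
    · exact hτ
  -- Here `σ` is the foot of the perpendicular from `p`. The points `a` and `b` lie on one side of
  -- it with `a` no farther than `b`, so the point at `a` is nearer to the line through `p` and `b`
  -- than `p` is to its line.
  obtain ⟨a, ha, b, hb, hab, hsq⟩ := exists_pair_sq_sub_le zero_ne_one hτ0.symm hτ1.symm σ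
  have hbadne : ∀ t : ℝ,
      q + a • u ≠ q + b • u + t • (q + (σ • u + h) - (q + b • u)) := by
    intro t ht
    have h1 : (a - b - t * (σ - b)) • u = t • h := by
      have : a • u - b • u - t • (σ • u + h - b • u) = 0 := by
        rw [sub_eq_zero, sub_eq_iff_eq_add]
        have h2 : q + a • u = q + (t • (σ • u + h - b • u) + b • u) := by
          rw [ht]
          module
        exact add_left_cancel h2
      rw [← sub_eq_zero, ← this]
      module
    have h2 : t * ‖h‖ ^ 2 = 0 := by
      have := congrArg (fun z => ⟪h, z⟫) h1
      simpa only [inner_smul_right, hhu, mul_zero, real_inner_self_eq_norm_sq, eq_comm] using this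
    have ht0 : t = 0 := by simpa [hh0] using h2
    subst ht0
    simp [hu, sub_eq_zero, hab] at h1
  have hne' : q + b • u ≠ q + (σ • u + h) := by
    intro e
    have h1 : (b - σ) • u = h := by
      rw [sub_smul, sub_eq_iff_eq_add', add_left_cancel e]
    have h2 := congrArg (fun z => ⟪h, z⟫) h1
    simp only [inner_smul_right, hhu, mul_zero, real_inner_self_eq_norm_sq] at h2
    exact hh0 (by simpa using h2.symm)
  have hlt := hmin (q + a • u, q + b • u, q + (σ • u + h)) (by
    simp only [bad, Finset.mem_filter, Finset.mem_product]
    exact ⟨⟨hmemV a ha, hmemV b hb, hp⟩, hne', hbadne⟩)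
  refine hlt.not_gt ?_
  simp only []
  rw [lineDistSq_eq hu hhu]
  have e1 : q + a • u - (q + b • u) = (a - b) • u := by module
  have e2 : q + (σ • u + h) - (q + b • u) = (σ - b) • u + h := by module
  have hN : ‖(σ - b) • u + h‖ ^ 2 = (σ - b) ^ 2 * ‖u‖ ^ 2 + ‖h‖ ^ 2 := by
    rw [norm_add_sq_real, inner_smul_left, huh, norm_smul, Real.norm_eq_abs, mul_pow, sq_abs]
    simp
  have hhpos : 0 < ‖h‖ ^ 2 := by positivity
  have hupos : 0 < ‖u‖ ^ 2 := by positivity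
  have hNpos : 0 < (σ - b) ^ 2 * ‖u‖ ^ 2 + ‖h‖ ^ 2 := by positivity
  rw [lineDistSq, e1, e2, hN, inner_add_right, inner_smul_left, inner_smul_left, inner_smul_right,
    huh, real_inner_self_eq_norm_sq, norm_smul, Real.norm_eq_abs, mul_pow, sq_abs]
  simp only [conj_trivial, mul_zero, add_zero]
  rw [sub_lt_iff_lt_add, ← sub_lt_iff_lt_add', lt_div_iff₀ hNpos]
  nlinarith [mul_le_mul_of_nonneg_right hsq (mul_pos hhpos hupos).le, mul_pos hhpos hhpos]

/-- The projective form of the Sylvester–Gallai theorem for lines through the origin. -/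
theorem exists_forall_mem_span_pair (U : Finset E)
    (hind : ∀ u ∈ U, ∀ v ∈ U, u ≠ v → u ∉ Submodule.span ℝ {v}) (h0 : ∀ u ∈ U, u ≠ 0)
    (hU : ∀ u ∈ U, ∀ v ∈ U, u ≠ v → ∃ w ∈ U, w ≠ u ∧ w ≠ v ∧ w ∈ Submodule.span ℝ {u, v}) :
    ∃ e f : E, ∀ u ∈ U, u ∈ Submodule.span ℝ {e, f} := by
  classical
  obtain ⟨c, hc⟩ := exists_inner_ne_zero U
  replace hc : ∀ u ∈ U, ⟪u, c⟫ ≠ 0 := fun u hu => hc u hu (h0 u hu)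
  rcases U.eq_empty_or_nonempty with rfl | ⟨e, he⟩
  · exact ⟨0, 0, by simp⟩
  by_cases hf : ∃ f ∈ U, e ≠ f
  swap
  · push Not at hf
    exact ⟨e, e, fun u hu => by rw [← hf u hu]; exact Submodule.subset_span (by simp)⟩
  obtain ⟨f, hf, hef⟩ := hf
  -- Central projection to the affine hyperplane where the inner product with `c` is 1 turns lines
  -- through the origin into points and planes into lines.
  let φ : E → E := fun u => ⟪u, c⟫⁻¹ • u
  have hφ : ∀ u ∈ U, u = ⟪u, c⟫ • φ u := fun u hu => by
    simp only [φ]; rw [smul_inv_smul₀ (hc u hu)]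
  have hinj : ∀ u ∈ U, ∀ v ∈ U, u ≠ v → φ u ≠ φ v := by
    intro u hu v hv huv heq
    refine hind u hu v hv huv (Submodule.mem_span_singleton.2 ⟨⟪u, c⟫ * ⟪v, c⟫⁻¹, ?_⟩)
    rw [mul_smul]
    exact (heq ▸ hφ u hu).symm
  have hSG : ∀ p ∈ U.image φ, ∀ q ∈ U.image φ, p ≠ q →
      ∃ t : ℝ, t ≠ 0 ∧ t ≠ 1 ∧ p + t • (q - p) ∈ U.image φ := by
    simp only [Finset.mem_image]
    rintro _ ⟨u, hu, rfl⟩ _ ⟨v, hv, rfl⟩ huv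
    obtain ⟨w, hw, hwu, hwv, hwspan⟩ := hU u hu v hv (fun e => huv (by rw [e]))
    obtain ⟨α, β, hαβ⟩ := Submodule.mem_span_pair.1 hwspan
    have hwc : ⟪w, c⟫ = α * ⟪u, c⟫ + β * ⟪v, c⟫ := by
      rw [← hαβ, inner_add_left, inner_smul_left, inner_smul_left]; rfl
    have hw0 := hc w hw
    have hu0 := hc u hu
    have hv0 := hc v hv
    have hφw : φ u + (β * ⟪v, c⟫ / ⟪w, c⟫) • (φ v - φ u) = φ w := by
      have h1 : φ w = (⟪w, c⟫⁻¹ * α) • u + (⟪w, c⟫⁻¹ * β) • v := by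
        simp only [φ, mul_smul, ← smul_add]
        rw [hαβ]
      have h2 : φ u + (β * ⟪v, c⟫ / ⟪w, c⟫) • (φ v - φ u) =
          ((1 - β * ⟪v, c⟫ / ⟪w, c⟫) * ⟪u, c⟫⁻¹) • u +
            (β * ⟪v, c⟫ / ⟪w, c⟫ * ⟪v, c⟫⁻¹) • v := by
        simp only [φ]
        module
      rw [h1, h2]
      congr 2
      · field_simp
        rw [hwc]
        ring
      · field_simp
    refine ⟨β * ⟪v, c⟫ / ⟪w, c⟫, fun h => ?_, fun h => ?_, w, hw, hφw.symm⟩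
    · rw [h] at hφw
      exact hinj w hw u hu hwu (by rw [← hφw]; simp)
    · rw [h] at hφw
      exact hinj w hw v hv hwv (by rw [← hφw]; simp)
  refine ⟨e, f, fun u hu => ?_⟩
  obtain ⟨t, ht⟩ := sylvester_gallai (U.image φ) hSG (Finset.mem_image_of_mem φ hu)
    (Finset.mem_image_of_mem φ he) (Finset.mem_image_of_mem φ hf) (hinj e he f hf hef)
  have hes : e ∈ Submodule.span ℝ {e, f} := Submodule.subset_span (by simp)
  have hfs : f ∈ Submodule.span ℝ {e, f} := Submodule.subset_span (by simp)
  rw [hφ u hu, ht]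
  exact Submodule.smul_mem _ _ (Submodule.add_mem _ (Submodule.smul_mem _ _ hes)
    (Submodule.smul_mem _ _ (Submodule.sub_mem _ (Submodule.smul_mem _ _ hfs)
      (Submodule.smul_mem _ _ hes))))

theorem eq_or_eq_neg_of_mem_span_singleton {u v : E} (hu : ‖u‖ = 1) (hv : ‖v‖ = 1)
    (h : u ∈ Submodule.span ℝ {v}) : u = v ∨ u = -v := by
  obtain ⟨t, rfl⟩ := Submodule.mem_span_singleton.1 h
  rw [norm_smul, hv, mul_one, Real.norm_eq_abs, abs_eq zero_le_one] at hu
  rcases hu with rfl | rfl <;> simp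

/-- Unit vectors, no two of them opposite, whose sign sums are at most one lie in a plane. -/
theorem exists_forall_mem_span_pair_of_abs_signSum_le_one {U : Finset E}
    (hunit : ∀ u ∈ U, ‖u‖ = 1) (hneg : ∀ u ∈ U, -u ∉ U) (h : ∀ c, |signSum U c| ≤ 1) :
    ∃ e f : E, ∀ u ∈ U, u ∈ Submodule.span ℝ {e, f} := by
  classical
  refine exists_forall_mem_span_pair U ?_ ?_ ?_
  · intro u hu v hv huv hspan
    rcases eq_or_eq_neg_of_mem_span_singleton (hunit u hu) (hunit v hv) hspan with rfl | rfl
    exacts [huv rfl, hneg v hv hu]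
  · rintro u hu rfl
    simpa using hunit 0 hu
  · intro u hu v hv huv
    by_contra! hno
    have : FiniteDimensional ℝ (Submodule.span ℝ {u, v}) :=
      FiniteDimensional.span_of_finite ℝ (Set.toFinite _)
    have : CompleteSpace (Submodule.span ℝ {u, v}) := FiniteDimensional.complete ℝ _
    have hb := abs_signSum_filter_mem_le h (Submodule.span ℝ {u, v}) (u + v)
    have hset : U.filter (· ∈ Submodule.span ℝ {u, v}) = {u, v} := by
      ext w
      simp only [Finset.mem_filter, Finset.mem_insert, Finset.mem_singleton]
      constructor
      · rintro ⟨hw, hws⟩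
        by_contra! hne
        exact hno w hw hne.1 hne.2 hws
      · rintro (rfl | rfl)
        exacts [⟨hu, Submodule.subset_span (by simp)⟩, ⟨hv, Submodule.subset_span (by simp)⟩]
    -- Since `v ≠ -u`, both unit vectors have positive inner product with `u + v`.
    have hinner : -1 < ⟪u, v⟫ := by
      have h1 : u + v ≠ 0 := fun e => hneg u hu (by rwa [neg_eq_of_add_eq_zero_right e])
      have h2 : 0 < ‖u + v‖ ^ 2 := by positivity
      rw [norm_add_sq_real, hunit u hu, hunit v hv] at h2
      linarith
    have hsu : 0 < ⟪u, u + v⟫ := by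
      rw [inner_add_right, real_inner_self_eq_norm_sq, hunit u hu]
      linarith
    have hsv : 0 < ⟪v, u + v⟫ := by
      rw [inner_add_right, real_inner_self_eq_norm_sq, hunit v hv, real_inner_comm]
      linarith
    have hsum : signSum (U.filter (· ∈ Submodule.span ℝ {u, v})) (u + v) = 2 := by
      rw [hset, signSum, Finset.sum_pair huv, sign_pos hsu, sign_pos hsv]
      rfl
    have hb' : |(2 : ℤ)| ≤ 1 := by
      rw [← hsum]
      convert hb
    norm_num at hb'

end SylvesterGallai

/-! ### Alternating weights along an arc. -/

section Alternation

/-- As `k` is odd, the blocks before and after `m` have lengths of equal parity. If both are even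
each sums to zero; if both are odd they cancel. -/
theorem sum_range_neg_one_pow_mul {k m : ℕ} (hk : Odd k) (hm : m < k) (σ : ℕ → ℤ) (s : ℤ)
    (hlt : ∀ i < m, σ i = s) (hgt : ∀ i < k, m < i → σ i = -s) :
    ∑ i ∈ Finset.range k, (-1) ^ i * σ i = (-1) ^ m * σ m := by
  obtain ⟨j, rfl⟩ : ∃ j, k = m + 1 + j := ⟨k - (m + 1), by omega⟩
  have h1 : ∑ i ∈ Finset.range m, (-1) ^ i * σ i = (∑ i ∈ Finset.range m, (-1) ^ i) * s := by
    rw [Finset.sum_mul]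
    exact Finset.sum_congr rfl fun i hi => by rw [hlt i (Finset.mem_range.1 hi)]
  have h2 : ∑ i ∈ Finset.range j, (-1) ^ (m + 1 + i) * σ (m + 1 + i) =
      (-1) ^ m * (∑ i ∈ Finset.range j, (-1) ^ i) * s := by
    rw [Finset.mul_sum, Finset.sum_mul]
    refine Finset.sum_congr rfl fun i hi => ?_
    rw [hgt (m + 1 + i) (by have := Finset.mem_range.1 hi; omega) (by omega)]
    ring
  rw [Finset.sum_range_add, Finset.sum_range_succ, h1, h2, neg_one_geom_sum, neg_one_geom_sum]
  rcases Nat.even_or_odd m with hme | hmo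
  · have hj : Even j := by
      rw [← Nat.not_odd_iff_even] at *
      intro hj
      rw [Nat.odd_iff] at *
      omega
    simp [hme, hj]
  · have hj : Odd j := by
      rw [Nat.odd_iff] at *
      omega
    rw [← Nat.not_even_iff_odd] at hj
    rw [if_neg (Nat.not_even_iff_odd.2 hmo), if_neg hj, hmo.neg_one_pow]
    ring

/-- For increasing angles within a half turn all three coefficients are positive, so a linear form
at the middle direction is a positive combination of its values at the outer ones. -/
theorem sin_mul_add_sin_mul (α β x y z : ℝ) :
    Real.sin (z - y) * (Real.cos x * α + Real.sin x * β) +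
      Real.sin (y - x) * (Real.cos z * α + Real.sin z * β) =
      Real.sin (z - x) * (Real.cos y * α + Real.sin y * β) := by
  rw [Real.sin_sub, Real.sin_sub, Real.sin_sub]
  ring

/-- A nonzero linear form on the plane changes sign at most once along an arc shorter than a half
turn. -/
theorem exists_sign_change {k : ℕ} (hk : 0 < k) (θ : Fin k → ℝ) (hmono : StrictMono θ)
    (hπ : ∀ i j, θ j < θ i + Real.pi) (α β : ℝ) :
    ∃ (m : Fin k) (s : ℤ),
      (∀ i < m, (SignType.sign (Real.cos (θ i) * α + Real.sin (θ i) * β) : ℤ) = s) ∧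
      ∀ i, m < i → (SignType.sign (Real.cos (θ i) * α + Real.sin (θ i) * β) : ℤ) = -s := by
  classical
  let g : Fin k → ℝ := fun i => Real.cos (θ i) * α + Real.sin (θ i) * β
  have hsin : ∀ i j, i < j → 0 < Real.sin (θ j - θ i) := fun i j hij =>
    Real.sin_pos_of_pos_of_lt_pi (sub_pos.2 (hmono hij)) (by linarith [hπ i j])
  have hthree : ∀ i j l, Real.sin (θ l - θ j) * g i + Real.sin (θ j - θ i) * g l =
      Real.sin (θ l - θ i) * g j := fun i j l => sin_mul_add_sin_mul α β _ _ _
  let z : Fin k := ⟨0, hk⟩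
  have hz : ∀ i, z ≤ i := fun i => Nat.zero_le _
  change ∃ (m : Fin k) (s : ℤ), (∀ i < m, (SignType.sign (g i) : ℤ) = s) ∧
    ∀ i, m < i → (SignType.sign (g i) : ℤ) = -s
  by_cases h0 : g z = 0
  · by_cases hl : ∃ l, z < l
    · obtain ⟨l, hl⟩ := hl
      refine ⟨z, -(SignType.sign (g l) : ℤ), fun i hi => absurd hi (hz i).not_gt, ?_⟩
      intro j hj
      rw [neg_neg]
      have e := hthree z j l
      rw [h0, mul_zero, zero_add] at e
      have h1 := congrArg SignType.sign e
      rw [sign_mul, sign_mul, sign_pos (hsin _ _ hj), sign_pos (hsin _ _ hl), one_mul,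
        one_mul] at h1
      rw [h1]
    · push Not at hl
      exact ⟨z, 0, fun i hi => absurd hi (hz i).not_gt, fun i hi => absurd hi (hl i).not_gt⟩
  · by_cases hch : ∃ i, SignType.sign (g i) ≠ SignType.sign (g z)
    -- The change is placed at the first index whose sign differs from the initial one; the form may
    -- vanish there, which is why the sign at `m` is left free.
    · let C := Finset.univ.filter fun i => SignType.sign (g i) ≠ SignType.sign (g z)
      have hC : C.Nonempty := by
        obtain ⟨i, hi⟩ := hch
        exact ⟨i, by simpa [C] using hi⟩
      have hmC : C.min' hC ∈ C := Finset.min'_mem _ _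
      set m := C.min' hC with hm
      have hmz : SignType.sign (g m) ≠ SignType.sign (g z) := by simpa [C] using hmC
      have hzm : z < m := lt_of_le_of_ne (hz m) (by rintro h; rw [← h] at hmz; exact hmz rfl)
      refine ⟨m, SignType.sign (g z), ?_, ?_⟩
      · intro i hi
        by_contra hne
        refine hi.not_ge (Finset.min'_le _ _ ?_)
        simp only [C, Finset.mem_filter, Finset.mem_univ, true_and]
        intro h
        exact hne (by rw [h])
      · intro j hj
        have e := hthree z m j
        have p1 := hsin _ _ hj
        have p2 := hsin _ _ hzm
        have p3 := hsin _ _ (hzm.trans hj)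
        rcases lt_or_gt_of_ne h0 with hneg | hpos
        · have hgm : 0 ≤ g m := by
            by_contra! h
            exact hmz (by rw [sign_neg h, sign_neg hneg])
          have : 0 < g j := by
            by_contra! h
            nlinarith [mul_neg_of_pos_of_neg p1 hneg, mul_nonneg p3.le hgm,
              mul_nonpos_of_nonneg_of_nonpos p2.le h]
          rw [sign_pos this, sign_neg hneg]
          rfl
        · have hgm : g m ≤ 0 := by
            by_contra! h
            exact hmz (by rw [sign_pos h, sign_pos hpos])
          have : g j < 0 := by
            by_contra! h
            nlinarith [mul_pos p1 hpos, mul_nonpos_of_nonneg_of_nonpos p3.le hgm,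
              mul_nonneg p2.le h]
          rw [sign_neg this, sign_pos hpos]
          rfl
    · push Not at hch
      let m : Fin k := ⟨k - 1, by omega⟩
      refine ⟨m, SignType.sign (g z), fun i _ => by rw [hch i], fun i hi => ?_⟩
      have h1 := i.2
      have h2 : k - 1 < (i : ℕ) := hi
      omega

/-- Weights that alternate along an arc shorter than a half turn have small sign sums. -/
theorem abs_sum_weight_mul_sign_le_one {k : ℕ} (hk : Odd k) (θ : Fin k → ℝ) (hmono : StrictMono θ)
    (hπ : ∀ i j, θ j < θ i + Real.pi) (w : Fin k → ℤ) {w₀ : ℤ} (hw₀ : |w₀| ≤ 1)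
    (hw : ∀ i : Fin k, w i = (-1) ^ (i : ℕ) * w₀) (α β : ℝ) :
    |∑ i, w i * (SignType.sign (Real.cos (θ i) * α + Real.sin (θ i) * β) : ℤ)| ≤ 1 := by
  obtain ⟨m, s, hlt, hgt⟩ := exists_sign_change hk.pos θ hmono hπ α β
  let σ : ℕ → ℤ := fun i => if h : i < k then
    (SignType.sign (Real.cos (θ ⟨i, h⟩) * α + Real.sin (θ ⟨i, h⟩) * β) : ℤ) else 0
  have hσ : ∀ i : Fin k,
      σ i = (SignType.sign (Real.cos (θ i) * α + Real.sin (θ i) * β) : ℤ) := fun i => by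
    simp [σ]
  have hsum := sum_range_neg_one_pow_mul hk m.2 σ s
    (fun i hi => by
      have := hlt ⟨i, hi.trans m.2⟩ hi
      rwa [← hσ] at this)
    (fun i hi hmi => by
      have := hgt ⟨i, hi⟩ hmi
      rwa [← hσ] at this)
  rw [Finset.sum_range] at hsum
  have heq : ∑ i, w i * (SignType.sign (Real.cos (θ i) * α + Real.sin (θ i) * β) : ℤ) =
      w₀ * ((-1) ^ (m : ℕ) * σ m) := by
    rw [← hsum, Finset.mul_sum]
    refine Finset.sum_congr rfl fun i _ => ?_
    rw [hw, hσ]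
    ring
  have hσ1 : |σ m| ≤ 1 := by
    rw [hσ]
    rcases SignType.sign (Real.cos (θ m) * α + Real.sin (θ m) * β) with _ | _ | _ <;> decide
  rw [heq, abs_mul, abs_mul, abs_pow, abs_neg, abs_one, one_pow, one_mul]
  exact mul_le_one₀ hw₀ (abs_nonneg _) hσ1

/-- Weights `±1` along an arc shorter than a half turn alternate if their sign sums are small. -/
theorem weight_eq_of_abs_sum_le_one {k : ℕ} (hk : Odd k) (θ : Fin k → ℝ) (hmono : StrictMono θ)
    (hπ : ∀ i j, θ j < θ i + Real.pi) (w : Fin k → ℤ) (hw : ∀ i, w i = 1 ∨ w i = -1)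
    (h : ∀ α β : ℝ,
      |∑ i, w i * (SignType.sign (Real.cos (θ i) * α + Real.sin (θ i) * β) : ℤ)| ≤ 1)
    (i : Fin k) : w i = (-1) ^ (i : ℕ) * w ⟨0, hk.pos⟩ := by
  classical
  -- The sign pattern of the linear form that vanishes in direction `m`.
  let ρ : Fin k → Fin k → ℤ := fun m i => if i < m then 1 else if i = m then 0 else -1
  have hρ : ∀ m i, (SignType.sign (Real.cos (θ i) * Real.sin (θ m) +
      Real.sin (θ i) * -Real.cos (θ m)) : ℤ) = ρ m i := by
    intro m i
    have e : Real.cos (θ i) * Real.sin (θ m) + Real.sin (θ i) * -Real.cos (θ m) =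
        Real.sin (θ m - θ i) := by rw [Real.sin_sub]; ring
    rw [e]
    simp only [ρ]
    split_ifs with h1 h2
    · rw [sign_pos (Real.sin_pos_of_pos_of_lt_pi (sub_pos.2 (hmono h1)) (by linarith [hπ i m]))]
      rfl
    · simp [h2]
    · have hlt : m < i := lt_of_le_of_ne (not_lt.1 h1) (Ne.symm h2)
      rw [sign_neg (Real.sin_neg_of_neg_of_neg_pi_lt (sub_neg.2 (hmono hlt))
        (by linarith [hπ m i]))]
      rfl
  have hzero : ∀ m, ∑ i, w i * ρ m i = 0 := by
    intro m
    have h1 := h (Real.sin (θ m)) (-Real.cos (θ m))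
    simp only [hρ] at h1
    -- The sum has `k - 1` terms `±1`, an even number, so it is even; being at most 1 in absolute
    -- value, it is zero.
    have h2 : ((∑ i, w i * ρ m i : ℤ) : ZMod 2) = 0 := by
      have hterm : ∀ i, ((w i * ρ m i : ℤ) : ZMod 2) = 1 - if i = m then 1 else 0 := by
        intro i
        rcases hw i with hwi | hwi <;> simp only [hwi, ρ] <;> split_ifs with h1 h2 <;>
          first
          | exact absurd h2 h1.ne
          | decide
      rw [Int.cast_sum, Finset.sum_congr rfl fun i _ => hterm i, Finset.sum_sub_distrib]
      simp only [Finset.sum_const, Finset.card_univ, Fintype.card_fin, Finset.sum_ite_eq',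
        Finset.mem_univ, if_true, nsmul_eq_mul, mul_one]
      rw [(ZMod.natCast_eq_one_iff_odd).2 hk, sub_self]
    rw [ZMod.intCast_zmod_eq_zero_iff_dvd] at h2
    rw [abs_le] at h1
    omega
  have hstep : ∀ n (hn : n + 1 < k), w ⟨n + 1, hn⟩ = -w ⟨n, by omega⟩ := by
    intro n hn
    -- Patterns for consecutive `m` differ only at those two indices, by 1 at each, so the two
    -- weights add up to zero.
    have hdiff : ∑ i, w i * (ρ ⟨n + 1, hn⟩ i - ρ ⟨n, by omega⟩ i) = 0 := by
      simp only [mul_sub, Finset.sum_sub_distrib, hzero, sub_self]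
    have hterm : ∀ i : Fin k, w i * (ρ ⟨n + 1, hn⟩ i - ρ ⟨n, by omega⟩ i) =
        (if i = ⟨n, by omega⟩ then w i else 0) + if i = ⟨n + 1, hn⟩ then w i else 0 := by
      rintro ⟨i, hi⟩
      simp only [ρ, Fin.mk_lt_mk, Fin.mk.injEq]
      rcases lt_trichotomy i n with h1 | rfl | h1
      · simp [h1, h1.trans (Nat.lt_succ_self n), h1.ne, (h1.trans (Nat.lt_succ_self n)).ne]
      · simp
      · rcases (Nat.succ_le_of_lt h1).eq_or_lt with h2 | h2
        · obtain rfl : i = n + 1 := h2.symm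
          simp
        · have h2' : n + 1 < i := h2
          simp [h1.not_gt, h1.ne', h2'.not_gt, h2'.ne']
    rw [Finset.sum_congr rfl fun i _ => hterm i, Finset.sum_add_distrib, Finset.sum_ite_eq',
      Finset.sum_ite_eq'] at hdiff
    simp only [Finset.mem_univ, if_true] at hdiff
    omega
  obtain ⟨n, hn⟩ := i
  induction n with
  | zero => simp
  | succ n ih =>
    rw [hstep n hn, ih (by omega)]
    simp only [pow_succ]
    ring

end Alternation

/-! ### Reduction to the odd directions. -/

section OddDirections

variable {E : Type*} [NormedAddCommGroup E] [InnerProductSpace ℝ E]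

open scoped Classical in
/-- The number of vectors of `A` that are positive multiples of `u`. -/
noncomputable def rayCount (A : Finset E) (u : E) : ℕ :=
  (A.filter fun a => ∃ t : ℝ, 0 < t ∧ a = t • u).card

/-- The number of positive multiples of `u` in `A` minus the number of negative ones. -/
noncomputable def excess (A : Finset E) (u : E) : ℤ :=
  (rayCount A u : ℤ) - rayCount A (-u)

theorem excess_neg (A : Finset E) (u : E) : excess A (-u) = -excess A u := by
  simp [excess]

theorem rayCount_smul (A : Finset E) (u : E) {s : ℝ} (hs : 0 < s) :
    rayCount A (s • u) = rayCount A u := by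
  classical
  unfold rayCount
  congr 1
  refine Finset.filter_congr fun a _ => ⟨?_, ?_⟩
  · rintro ⟨t, ht, rfl⟩
    exact ⟨t * s, mul_pos ht hs, by rw [mul_smul]⟩
  · rintro ⟨t, ht, rfl⟩
    exact ⟨t / s, div_pos ht hs, by rw [smul_smul, div_mul_cancel₀ _ hs.ne']⟩

theorem excess_smul (A : Finset E) (u : E) {s : ℝ} (hs : 0 < s) :
    excess A (s • u) = excess A u := by
  rw [excess, excess, ← smul_neg, rayCount_smul A u hs, rayCount_smul A (-u) hs]

open scoped Classical in
theorem signSum_filter_span_singleton (A : Finset E) {v : E} (hv : v ≠ 0) :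
    signSum (A.filter (· ∈ Submodule.span ℝ {v})) v = excess A v := by
  have hv2 : 0 < ‖v‖ ^ 2 := by positivity
  rw [signSum_eq_card_sub_card, excess, rayCount, rayCount, Finset.filter_filter,
    Finset.filter_filter]
  congr 3
  · refine Finset.filter_congr fun a _ => ⟨?_, ?_⟩
    · rintro ⟨h1, h2⟩
      obtain ⟨t, rfl⟩ := Submodule.mem_span_singleton.1 h1
      rw [real_inner_smul_left, real_inner_self_eq_norm_sq] at h2
      exact ⟨t, (pos_iff_pos_of_mul_pos h2).2 hv2, rfl⟩
    · rintro ⟨t, ht, rfl⟩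
      refine ⟨Submodule.mem_span_singleton.2 ⟨t, rfl⟩, ?_⟩
      rw [real_inner_smul_left, real_inner_self_eq_norm_sq]
      exact mul_pos ht hv2
  · refine Finset.filter_congr fun a _ => ⟨?_, ?_⟩
    · rintro ⟨h1, h2⟩
      obtain ⟨t, rfl⟩ := Submodule.mem_span_singleton.1 h1
      rw [real_inner_smul_left, real_inner_self_eq_norm_sq] at h2
      exact ⟨-t, neg_pos.2 (neg_of_mul_neg_left h2 hv2.le), by simp⟩
    · rintro ⟨t, ht, rfl⟩
      refine ⟨Submodule.mem_span_singleton.2 ⟨-t, by simp⟩, ?_⟩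
      rw [real_inner_smul_left, inner_neg_left, real_inner_self_eq_norm_sq]
      nlinarith [mul_pos ht hv2]

theorem abs_excess_le {A : Finset E} {δ : ℤ} (h : ∀ c, |signSum A c| ≤ δ) {v : E} (hv : v ≠ 0) :
    |excess A v| ≤ δ := by
  classical
  rw [← signSum_filter_span_singleton A hv]
  convert abs_signSum_filter_mem_le h (Submodule.span ℝ {v}) v

open scoped Classical in
/-- The unit vectors in whose direction `A` has one vector more than in the opposite direction. -/
noncomputable def oddDirections (A : Finset E) : Finset E :=
  ((A.erase 0).image fun a => ‖a‖⁻¹ • a).filter fun u => excess A u = 1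

theorem mem_oddDirections {A : Finset E} {u : E} :
    u ∈ oddDirections A ↔ ‖u‖ = 1 ∧ excess A u = 1 := by
  classical
  simp only [oddDirections, Finset.mem_filter, Finset.mem_image, Finset.mem_erase]
  constructor
  · rintro ⟨⟨a, ⟨ha, -⟩, rfl⟩, h⟩
    exact ⟨norm_smul_inv_norm (𝕜 := ℝ) ha, h⟩
  · rintro ⟨hu, h⟩
    refine ⟨?_, h⟩
    have hpos : 0 < rayCount A u := by
      rw [excess] at h
      omega
    obtain ⟨a, ha⟩ := Finset.card_pos.1 hpos
    obtain ⟨haA, t, ht, rfl⟩ := Finset.mem_filter.1 ha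
    have hu0 : u ≠ 0 := by rintro rfl; simp at hu
    refine ⟨t • u, ⟨smul_ne_zero ht.ne' hu0, haA⟩, ?_⟩
    rw [norm_smul, hu, mul_one, Real.norm_of_nonneg ht.le, inv_smul_smul₀ ht.ne']

theorem neg_notMem_oddDirections {A : Finset E} {u : E} (hu : u ∈ oddDirections A) :
    -u ∉ oddDirections A := by
  rw [mem_oddDirections] at *
  rw [excess_neg]
  omega

/-- If opposite directions are balanced up to one, only the odd directions contribute to the sign
sums. -/
theorem signSum_oddDirections {A : Finset E} (h : ∀ u, u ≠ 0 → |excess A u| ≤ 1) (c : E) :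
    signSum (oddDirections A) c = signSum A c := by
  classical
  let V := (A.erase 0).image fun a => ‖a‖⁻¹ • a
  -- Closed under negation, so each sum below can be averaged with its reflection.
  let N := V ∪ V.image fun u => -u
  have hV1 : ∀ u ∈ V, ‖u‖ = 1 := by
    simp only [V, Finset.mem_image, Finset.mem_erase]
    rintro _ ⟨a, ⟨ha, -⟩, rfl⟩
    exact norm_smul_inv_norm (𝕜 := ℝ) ha
  have hN1 : ∀ u ∈ N, ‖u‖ = 1 := by
    simp only [N, Finset.mem_union, Finset.mem_image]
    rintro _ (hu | ⟨u, hu, rfl⟩)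
    · exact hV1 _ hu
    · rw [norm_neg, hV1 u hu]
  have hNneg : ∀ u, u ∈ N ↔ -u ∈ N := by
    intro u
    simp only [N, Finset.mem_union, Finset.mem_image]
    constructor
    · rintro (hu | ⟨v, hv, rfl⟩)
      · exact Or.inr ⟨u, hu, rfl⟩
      · exact Or.inl (by simpa using hv)
    · rintro (hu | ⟨v, hv, hvu⟩)
      · exact Or.inr ⟨-u, hu, by simp⟩
      · exact Or.inl (by rwa [← neg_injective hvu])
  have hflip : ∀ F : E → ℤ, ∑ u ∈ N, F (-u) = ∑ u ∈ N, F u := fun F =>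
    Finset.sum_equiv (Equiv.neg E) hNneg fun u _ => rfl
  let s : E → ℤ := fun u => (SignType.sign ⟪u, c⟫ : ℤ)
  have hs : ∀ u, s (-u) = -s u := fun u => by
    simp [s, inner_neg_left, Left.sign_neg]
  have hray : signSum A c = ∑ u ∈ N, (rayCount A u : ℤ) * s u := by
    have h1 : signSum A c = ∑ a ∈ A.erase 0, s a := by
      rw [Finset.sum_erase _ (by simp [s])]
      rfl
    have hmaps : ∀ a ∈ A.erase 0, ‖a‖⁻¹ • a ∈ N := fun a ha =>
      Finset.mem_union_left _ (Finset.mem_image_of_mem _ ha)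
    rw [h1, ← Finset.sum_fiberwise_of_maps_to hmaps]
    refine Finset.sum_congr rfl fun u hu => ?_
    have hu1 := hN1 u hu
    have hu0 : u ≠ 0 := by rintro rfl; simp at hu1
    have hfil : (A.erase 0).filter (fun a => ‖a‖⁻¹ • a = u) =
        A.filter fun a => ∃ t : ℝ, 0 < t ∧ a = t • u := by
      ext a
      simp only [Finset.mem_filter, Finset.mem_erase]
      constructor
      · rintro ⟨⟨ha, haA⟩, rfl⟩
        exact ⟨haA, ‖a‖, norm_pos_iff.2 ha, by rw [smul_inv_smul₀ (norm_ne_zero_iff.2 ha)]⟩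
      · rintro ⟨haA, t, ht, rfl⟩
        refine ⟨⟨smul_ne_zero ht.ne' hu0, haA⟩, ?_⟩
        rw [norm_smul, hu1, mul_one, Real.norm_of_nonneg ht.le, inv_smul_smul₀ ht.ne']
    rw [hfil, Finset.sum_congr rfl (g := fun _ => s u), Finset.sum_const, nsmul_eq_mul]
    · rfl
    · intro a ha
      obtain ⟨-, t, ht, rfl⟩ := Finset.mem_filter.1 ha
      simp only [s]
      rw [real_inner_smul_left, sign_mul, sign_pos ht, one_mul]
  have hodd : signSum (oddDirections A) c = ∑ u ∈ N, if excess A u = 1 then s u else 0 := by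
    rw [signSum, ← Finset.sum_filter]
    refine Finset.sum_congr ?_ fun u _ => rfl
    ext u
    rw [mem_oddDirections, Finset.mem_filter]
    constructor
    · intro hu
      have := mem_oddDirections.2 hu
      exact ⟨Finset.mem_union_left _ (Finset.mem_filter.1 this).1, hu.2⟩
    · rintro ⟨hu, hu'⟩
      exact ⟨hN1 u hu, hu'⟩
  -- Averaging replaces ray counts by excesses, and in `e2` the indicator of excess 1 by the excess
  -- itself, whose only values are `-1`, `0`, `1`.
  have e1 : 2 * signSum A c = ∑ u ∈ N, excess A u * s u := by
    have : signSum A c = -∑ u ∈ N, (rayCount A (-u) : ℤ) * s u := by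
      rw [hray, ← hflip, ← Finset.sum_neg_distrib]
      refine Finset.sum_congr rfl fun u _ => ?_
      rw [hs]
      ring
    simp only [excess, sub_mul, Finset.sum_sub_distrib]
    rw [← hray]
    linarith
  have e2 : 2 * signSum (oddDirections A) c = ∑ u ∈ N, excess A u * s u := by
    have : signSum (oddDirections A) c =
        -∑ u ∈ N, if excess A u = -1 then s u else 0 := by
      rw [hodd, ← hflip, ← Finset.sum_neg_distrib]
      refine Finset.sum_congr rfl fun u _ => ?_
      rw [hs, excess_neg]
      by_cases hu : excess A u = -1
      · simp [hu]
      · rw [if_neg hu, if_neg (by omega)]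
        simp
    rw [two_mul]
    nth_rewrite 1 [hodd]
    rw [this, ← sub_eq_add_neg, ← Finset.sum_sub_distrib]
    refine Finset.sum_congr rfl fun u hu => ?_
    have hu1 := hN1 u hu
    have hb := abs_le.1 (h u (by rintro rfl; simp at hu1))
    have hcases : excess A u = -1 ∨ excess A u = 0 ∨ excess A u = 1 := by omega
    rcases hcases with e | e | e <;> simp [e]
  linarith

/-- At a generic `c` the sign sum of `A` has the parity of `A.card - 1`, and that of the odd
directions has the parity of their number. The two sums agree. -/
theorem odd_card_oddDirections {A : Finset E} (hA : Even A.card) (h0 : (0 : E) ∈ A)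
    (h : ∀ u, u ≠ 0 → |excess A u| ≤ 1) : Odd (oddDirections A).card := by
  classical
  obtain ⟨c, hc⟩ := exists_inner_ne_zero (A ∪ oddDirections A)
  have hU0 : (0 : E) ∉ oddDirections A := fun h => by
    have := (mem_oddDirections.1 h).1
    simp at this
  have e := signSum_oddDirections h c
  have h1 := card_eq_card_pos_add_card_neg_add_card_zero A c
  have h2 := card_eq_card_pos_add_card_neg_add_card_zero (oddDirections A) c
  rw [filter_inner_eq_zero_of_generic fun a ha => hc a (Finset.mem_union_left _ ha),
    if_pos h0] at h1
  rw [filter_inner_eq_zero_of_generic fun a ha => hc a (Finset.mem_union_right _ ha),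
    if_neg hU0] at h2
  rw [signSum_eq_card_sub_card, signSum_eq_card_sub_card] at e
  rw [Nat.even_iff] at hA
  rw [Nat.odd_iff]
  omega

theorem zero_notMem_of_oddDirections_eq_empty {A : Finset E} (hA : Even A.card)
    (h : ∀ u, u ≠ 0 → |excess A u| ≤ 1) (hU : oddDirections A = ∅) : (0 : E) ∉ A := by
  intro h0
  have := odd_card_oddDirections hA h0 h
  simp [hU] at this

end OddDirections

/-! ### Planes and polar angles. -/

section Planes

theorem exists_le_finrank_eq {E : Type*} [AddCommGroup E] [Module ℝ E] [FiniteDimensional ℝ E]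
    {k : ℕ} (hk : k ≤ Module.finrank ℝ E) (Q : Submodule ℝ E) (hQ : Module.finrank ℝ Q ≤ k) :
    ∃ Q' : Submodule ℝ E, Q ≤ Q' ∧ Module.finrank ℝ Q' = k := by
  induction hn : k - Module.finrank ℝ Q generalizing Q with
  | zero => exact ⟨Q, le_rfl, by omega⟩
  | succ n ih =>
    obtain ⟨v, hv⟩ : ∃ v, v ∉ Q := by
      by_contra! h
      have : Q = ⊤ := eq_top_iff.2 fun v _ => h v
      rw [this, finrank_top] at hn
      omega
    have hlt : Q < Q ⊔ Submodule.span ℝ {v} := by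
      refine lt_of_le_of_ne le_sup_left fun e => hv ?_
      rw [e]
      exact Submodule.mem_sup_right (Submodule.mem_span_singleton_self v)
    have h1 := Submodule.finrank_lt_finrank_of_lt hlt
    have h2 := Submodule.finrank_add_le_finrank_add_finrank Q (Submodule.span ℝ {v})
    have h3 : Module.finrank ℝ (Submodule.span ℝ {v}) ≤ 1 := by
      have h := finrank_span_finset_le_card (R := ℝ) ({v} : Finset E)
      rwa [Finset.coe_singleton, Finset.card_singleton] at h
    obtain ⟨Q', hQQ', hQ'⟩ := ih (Q ⊔ Submodule.span ℝ {v}) (by omega) (by omega)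
    exact ⟨Q', le_sup_left.trans hQQ', hQ'⟩

theorem exists_plane {E : Type*} [AddCommGroup E] [Module ℝ E] [FiniteDimensional ℝ E]
    (h2 : 2 ≤ Module.finrank ℝ E) (e f : E) :
    ∃ Q : Submodule ℝ E, Module.finrank ℝ Q = 2 ∧ Submodule.span ℝ {e, f} ≤ Q := by
  classical
  have h3 : Module.finrank ℝ (Submodule.span ℝ {e, f}) ≤ 2 := by
    have h := finrank_span_finset_le_card (R := ℝ) ({e, f} : Finset E)
    rw [Finset.coe_pair] at h
    exact h.trans Finset.card_le_two
  obtain ⟨Q, hQ, hQ2⟩ := exists_le_finrank_eq h2 _ h3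
  exact ⟨Q, hQ2, hQ⟩

/-- Replacing a unit vector by its negative keeps the line, so one angle in `[0, π)` per line
suffices. -/
theorem exists_angle {α β : ℝ} (h : α ^ 2 + β ^ 2 = 1) :
    ∃ θ : ℝ, 0 ≤ θ ∧ θ < Real.pi ∧
      ((α = Real.cos θ ∧ β = Real.sin θ) ∨ (α = -Real.cos θ ∧ β = -Real.sin θ)) := by
  have key : ∀ α β : ℝ, α ^ 2 + β ^ 2 = 1 → 0 < β →
      ∃ θ : ℝ, 0 ≤ θ ∧ θ < Real.pi ∧ α = Real.cos θ ∧ β = Real.sin θ := by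
    intro α β h hβ
    have h1 : -1 < α := by nlinarith [sq_pos_of_pos hβ]
    have h2 : α ≤ 1 := by nlinarith [sq_pos_of_pos hβ]
    refine ⟨Real.arccos α, Real.arccos_nonneg _, ?_, (Real.cos_arccos h1.le h2).symm, ?_⟩
    · refine lt_of_le_of_ne (Real.arccos_le_pi _) fun e => ?_
      rw [Real.arccos_eq_pi] at e
      linarith
    · rw [Real.sin_arccos, show 1 - α ^ 2 = β ^ 2 by linarith, Real.sqrt_sq hβ.le]
  rcases lt_trichotomy β 0 with hβ | rfl | hβ
  · obtain ⟨θ, h0, hπ, h1, h2⟩ := key (-α) (-β) (by linarith) (by linarith)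
    exact ⟨θ, h0, hπ, Or.inr ⟨by linarith, by linarith⟩⟩
  · refine ⟨0, le_rfl, Real.pi_pos, ?_⟩
    have : α = 1 ∨ α = -1 := mul_self_eq_one_iff.1 (by linarith)
    simpa using this
  · obtain ⟨θ, h0, hπ, h1, h2⟩ := key α β h hβ
    exact ⟨θ, h0, hπ, Or.inl ⟨h1, h2⟩⟩

theorem exists_orthonormal_pair {E : Type*} [NormedAddCommGroup E] [InnerProductSpace ℝ E]
    (Q : Submodule ℝ E) (hQ : Module.finrank ℝ Q = 2) :
    ∃ e ∈ Q, ∃ f ∈ Q, ‖e‖ = 1 ∧ ‖f‖ = 1 ∧ ⟪e, f⟫ = 0 ∧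
      ∀ u ∈ Q, ∃ α β : ℝ, u = α • e + β • f := by
  have : FiniteDimensional ℝ Q := Module.finite_of_finrank_pos (by omega)
  let b := (stdOrthonormalBasis ℝ Q).reindex (finCongr hQ)
  refine ⟨b 0, (b 0).2, b 1, (b 1).2, b.norm_eq_one 0, b.norm_eq_one 1, ?_, fun u hu => ?_⟩
  · exact b.inner_eq_zero (by decide)
  · refine ⟨b.repr ⟨u, hu⟩ 0, b.repr ⟨u, hu⟩ 1, ?_⟩
    have := congrArg (Subtype.val) (b.sum_repr ⟨u, hu⟩)
    rw [Fin.sum_univ_two] at this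
    simpa using this.symm

end Planes

/-! ### From lines through `x` to excesses of directions. -/

section Lines

variable {d : ℕ}

theorem countIn_openHalfLine (S : Finset (EuclideanSpace ℝ (Fin d)))
    (x v : EuclideanSpace ℝ (Fin d)) :
    countIn S (openHalfLine x v) = rayCount (centered S x) v := by
  classical
  rw [rayCount, card_filter_centered, openHalfLine, countIn_eq_card_filter]
  congr 1
  refine Finset.filter_congr fun y _ => ?_
  simp only [sub_eq_iff_eq_add']

theorem isLineThrough_iff {x : EuclideanSpace ℝ (Fin d)}
    {l : AffineSubspace ℝ (EuclideanSpace ℝ (Fin d))} :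
    IsLineThrough x l ↔ ∃ v, ‖v‖ = 1 ∧ l = AffineSubspace.mk' x (Submodule.span ℝ {v}) := by
  constructor
  · rintro ⟨hx, hl⟩
    obtain ⟨v, hv, hspan⟩ := finrank_eq_one_iff'.1 hl
    have hv0 : (v : EuclideanSpace ℝ (Fin d)) ≠ 0 := fun h => hv (Subtype.ext h)
    refine ⟨‖(v : EuclideanSpace ℝ (Fin d))‖⁻¹ • v, norm_smul_inv_norm (𝕜 := ℝ) hv0, ?_⟩
    rw [Submodule.span_singleton_smul_eq (isUnit_iff_ne_zero.2 (by simpa using hv0)),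
      eq_comm]
    refine Eq.trans ?_ (AffineSubspace.mk'_eq hx)
    congr 1
    ext w
    rw [Submodule.mem_span_singleton]
    constructor
    · rintro ⟨c, rfl⟩
      exact Submodule.smul_mem _ _ v.2
    · intro hw
      obtain ⟨c, hc⟩ := hspan ⟨w, hw⟩
      exact ⟨c, congrArg Subtype.val hc⟩
  · rintro ⟨v, hv, rfl⟩
    have hv0 : v ≠ 0 := by rintro rfl; simp at hv
    exact ⟨AffineSubspace.self_mem_mk' _ _, by
      rw [AffineSubspace.direction_mk', finrank_span_singleton hv0]⟩

theorem isBalancedLine_mk'_iff {S : Finset (EuclideanSpace ℝ (Fin d))}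
    {x v : EuclideanSpace ℝ (Fin d)} (hv : ‖v‖ = 1) :
    IsBalancedLine S x (AffineSubspace.mk' x (Submodule.span ℝ {v})) ↔
      |excess (centered S x) v| ≤ 1 := by
  have hv0 : v ≠ 0 := by rintro rfl; simp at hv
  simp only [IsBalancedLine, AffineSubspace.direction_mk', countIn_openHalfLine]
  constructor
  · exact fun h => h.2 v (Submodule.mem_span_singleton_self v) hv0
  · refine fun h => ⟨isLineThrough_iff.2 ⟨v, hv, rfl⟩, fun w hw hw0 => ?_⟩
    obtain ⟨t, rfl⟩ := Submodule.mem_span_singleton.1 hw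
    change |excess (centered S x) (t • v)| ≤ 1
    rcases lt_trichotomy t 0 with ht | rfl | ht
    · rw [show t • v = -((-t) • v) by simp, excess_neg, excess_smul _ _ (neg_pos.2 ht), abs_neg]
      exact h
    · simp at hw0
    · rwa [excess_smul _ _ ht]

theorem forall_isBalancedLine_iff {S : Finset (EuclideanSpace ℝ (Fin d))}
    {x : EuclideanSpace ℝ (Fin d)} :
    (∀ l, IsLineThrough x l → IsBalancedLine S x l) ↔
      ∀ u, u ≠ 0 → |excess (centered S x) u| ≤ 1 := by
  constructor
  · intro h u hu
    have hn : ‖‖u‖⁻¹ • u‖ = 1 := norm_smul_inv_norm (𝕜 := ℝ) hu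
    have := (isBalancedLine_mk'_iff hn).1 (h _ (isLineThrough_iff.2 ⟨_, hn, rfl⟩))
    rwa [excess_smul _ _ (inv_pos.2 (norm_pos_iff.2 hu))] at this
  · intro h l hl
    obtain ⟨v, hv, rfl⟩ := isLineThrough_iff.1 hl
    exact (isBalancedLine_mk'_iff hv).2 (h v (by rintro rfl; simp at hv))

theorem countIn_mk'_diff_singleton (S : Finset (EuclideanSpace ℝ (Fin d)))
    {x v : EuclideanSpace ℝ (Fin d)} (hv : v ≠ 0) :
    countIn S ((AffineSubspace.mk' x (Submodule.span ℝ {v}) :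
      Set (EuclideanSpace ℝ (Fin d))) \ {x}) =
      rayCount (centered S x) v + rayCount (centered S x) (-v) := by
  classical
  rw [← countIn_openHalfLine, ← countIn_openHalfLine, countIn, countIn, countIn,
    ← Set.ncard_union_eq]
  · rw [← Set.union_inter_distrib_right]
    congr 2
    ext y
    simp only [Set.mem_sdiff, SetLike.mem_coe, AffineSubspace.mem_mk', vsub_eq_sub,
      Submodule.mem_span_singleton, Set.mem_singleton_iff, Set.mem_union, openHalfLine,
      Set.mem_ofPred_eq]
    constructor
    · rintro ⟨⟨t, ht⟩, hy⟩
      have hyx : y = x + t • v := by rw [ht]; abel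
      rcases lt_trichotomy t 0 with h | rfl | h
      · exact Or.inr ⟨-t, neg_pos.2 h, by simpa using hyx⟩
      · exact absurd (by simpa using hyx) hy
      · exact Or.inl ⟨t, h, hyx⟩
    · rintro (⟨t, ht, rfl⟩ | ⟨t, ht, rfl⟩)
      · exact ⟨⟨t, by simp⟩, by simp [hv, ht.ne']⟩
      · exact ⟨⟨-t, by simp⟩, by simp [hv, ht.ne']⟩
  · refine Set.disjoint_left.2 ?_
    rintro y ⟨⟨t, ht, rfl⟩, -⟩ ⟨⟨s, hs, h⟩, -⟩
    have h1 : (t + s) • v = 0 := by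
      rw [add_smul, add_left_cancel h]
      simp
    rcases smul_eq_zero.1 h1 with h2 | h2
    · linarith
    · exact hv h2

theorem mk'_span_neg (x v : EuclideanSpace ℝ (Fin d)) :
    AffineSubspace.mk' x (Submodule.span ℝ {-v}) = AffineSubspace.mk' x (Submodule.span ℝ {v}) := by
  rw [← Set.neg_singleton, Submodule.span_neg]

theorem mk'_span_inj {x u v : EuclideanSpace ℝ (Fin d)} (hu : ‖u‖ = 1) (hv : ‖v‖ = 1)
    (h : AffineSubspace.mk' x (Submodule.span ℝ {u}) =
      AffineSubspace.mk' x (Submodule.span ℝ {v})) : u = v ∨ u = -v := by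
  have := congrArg AffineSubspace.direction h
  rw [AffineSubspace.direction_mk', AffineSubspace.direction_mk'] at this
  exact eq_or_eq_neg_of_mem_span_singleton hu hv
    (this ▸ Submodule.mem_span_singleton_self u)

/-- The sum and the difference of the two ray counts have the same parity, and an odd difference of
absolute value at most 1 is `±1`. -/
theorem mk'_span_mem_oddBalancedLines_iff {S : Finset (EuclideanSpace ℝ (Fin d))}
    {x v : EuclideanSpace ℝ (Fin d)} (hv : ‖v‖ = 1) :
    AffineSubspace.mk' x (Submodule.span ℝ {v}) ∈ oddBalancedLines S x ↔
      excess (centered S x) v = 1 ∨ excess (centered S x) v = -1 := by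
  have hv0 : v ≠ 0 := by rintro rfl; simp at hv
  change _ ∧ _ ↔ _
  rw [isBalancedLine_mk'_iff hv, countIn_mk'_diff_singleton S hv0, Nat.odd_iff, excess, abs_le]
  omega

theorem oddBalancedLines_eq_image (S : Finset (EuclideanSpace ℝ (Fin d)))
    (x : EuclideanSpace ℝ (Fin d)) :
    oddBalancedLines S x = (fun u => AffineSubspace.mk' x (Submodule.span ℝ {u})) ''
      (oddDirections (centered S x) : Set (EuclideanSpace ℝ (Fin d))) := by
  ext l
  constructor
  · intro hl
    obtain ⟨v, hv, rfl⟩ := isLineThrough_iff.1 hl.1.1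
    rcases (mk'_span_mem_oddBalancedLines_iff hv).1 hl with h | h
    · exact ⟨v, mem_oddDirections.2 ⟨hv, h⟩, rfl⟩
    · exact ⟨-v, mem_oddDirections.2 ⟨by rwa [norm_neg], by rw [excess_neg, h]; rfl⟩,
        mk'_span_neg x v⟩
  · rintro ⟨u, hu, rfl⟩
    have hu' := mem_oddDirections.1 hu
    exact (mk'_span_mem_oddBalancedLines_iff hu'.1).2 (Or.inl hu'.2)

theorem ncard_oddBalancedLines (S : Finset (EuclideanSpace ℝ (Fin d)))
    (x : EuclideanSpace ℝ (Fin d)) :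
    (oddBalancedLines S x).ncard = (oddDirections (centered S x)).card := by
  rw [oddBalancedLines_eq_image, Set.InjOn.ncard_image, Set.ncard_coe_finset]
  intro u hu v hv huv
  rcases mk'_span_inj (mem_oddDirections.1 hu).1 (mem_oddDirections.1 hv).1 huv with h | h
  · exact h
  · rw [h] at hu
    exact absurd hu (neg_notMem_oddDirections hv)

theorem norm_cos_smul_add_sin_smul {E : Type*} [NormedAddCommGroup E] [InnerProductSpace ℝ E]
    {e f : E} (he : ‖e‖ = 1) (hf : ‖f‖ = 1) (hef : ⟪e, f⟫ = 0) (θ : ℝ) :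
    ‖Real.cos θ • e + Real.sin θ • f‖ = 1 := by
  rw [← sq_eq_sq₀ (norm_nonneg _) zero_le_one, norm_add_sq_real, real_inner_smul_left,
    real_inner_smul_right, hef, norm_smul, norm_smul, he, hf]
  simp

theorem inner_cos_smul_add_sin_smul {E : Type*} [NormedAddCommGroup E] [InnerProductSpace ℝ E]
    {e f : E} (he : ‖e‖ = 1) (hf : ‖f‖ = 1) (hef : ⟪e, f⟫ = 0) (θ : ℝ) :
    ⟪Real.cos θ • e + Real.sin θ • f, e⟫ = Real.cos θ ∧
      ⟪Real.cos θ • e + Real.sin θ • f, f⟫ = Real.sin θ := by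
  have hfe : ⟪f, e⟫ = 0 := by rw [real_inner_comm, hef]
  simp [inner_add_left, real_inner_smul_left, hef, hfe, he, hf]

/-- With angles less than `π` apart this forces equal angles, so a rotational labelling lists no
line twice. -/
theorem sin_sub_eq_zero_of_eq_or_eq_neg {E : Type*} [NormedAddCommGroup E] [InnerProductSpace ℝ E]
    {e f : E} (he : ‖e‖ = 1) (hf : ‖f‖ = 1) (hef : ⟪e, f⟫ = 0) {θ φ : ℝ}
    (h : Real.cos θ • e + Real.sin θ • f = Real.cos φ • e + Real.sin φ • f ∨
      Real.cos θ • e + Real.sin θ • f = -(Real.cos φ • e + Real.sin φ • f)) :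
    Real.sin (θ - φ) = 0 := by
  obtain ⟨h1, h2⟩ := inner_cos_smul_add_sin_smul he hf hef θ
  obtain ⟨h3, h4⟩ := inner_cos_smul_add_sin_smul he hf hef φ
  rw [Real.sin_sub]
  rcases h with h | h
  · rw [h] at h1 h2
    rw [← h1, ← h2, h3, h4]
    ring
  · rw [h, inner_neg_left] at h1 h2
    rw [← h1, ← h2, h3, h4]
    ring

/-- In a rotational labelling the directions are, up to sign, the odd directions. -/
theorem IsRotationalLabelling.signSum_eq {S : Finset (EuclideanSpace ℝ (Fin d))}
    {x : EuclideanSpace ℝ (Fin d)} {P : AffineSubspace ℝ (EuclideanSpace ℝ (Fin d))} {k : ℕ}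
    {v : Fin k → EuclideanSpace ℝ (Fin d)} (h : IsRotationalLabelling S x P k v) :
    (∀ i, excess (centered S x) (v i) = 1 ∨ excess (centered S x) (v i) = -1) ∧
      k = (oddDirections (centered S x)).card ∧
      ∀ c, signSum (oddDirections (centered S x)) c =
        ∑ i, excess (centered S x) (v i) * (SignType.sign ⟪v i, c⟫ : ℤ) := by
  classical
  obtain ⟨hrange, e, -, f, -, he, hf, hef, θ, hmono, hπ, hv⟩ := h
  set A := centered S x
  have hv1 : ∀ i, ‖v i‖ = 1 := fun i => by
    rw [hv]; exact norm_cos_smul_add_sin_smul he hf hef _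
  have hexc : ∀ i, excess A (v i) = 1 ∨ excess A (v i) = -1 := fun i =>
    (mk'_span_mem_oddBalancedLines_iff (hv1 i)).1 (hrange ▸ Set.mem_range_self i)
  have hinj : ∀ i j, v i = v j ∨ v i = -v j → i = j := by
    intro i j hij
    rw [hv, hv] at hij
    have hs := sin_sub_eq_zero_of_eq_or_eq_neg he hf hef hij
    refine hmono.injective (sub_eq_zero.1 ?_)
    exact (Real.sin_eq_zero_iff_of_lt_of_lt (by linarith [hπ i j]) (by linarith [hπ j i])).1 hs
  -- Turn each label towards the heavier half-line; this gives a bijection onto the odd directions.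
  let w : Fin k → EuclideanSpace ℝ (Fin d) := fun i => if excess A (v i) = 1 then v i else -v i
  have hw : ∀ i, w i = v i ∨ w i = -v i := fun i => by
    simp only [w]
    split_ifs <;> simp
  have hmem : ∀ i ∈ Finset.univ, w i ∈ oddDirections A := by
    intro i _
    simp only [w]
    rw [mem_oddDirections]
    split_ifs with h1
    · exact ⟨hv1 i, h1⟩
    · refine ⟨by rw [norm_neg, hv1], ?_⟩
      rw [excess_neg, (hexc i).resolve_left h1]
      rfl
  have hwinj : Set.InjOn w (Finset.univ : Finset (Fin k)) := by
    intro i _ j _ hij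
    refine hinj i j ?_
    rcases hw i with hi | hi <;> rcases hw j with hj | hj <;> rw [hi, hj] at hij
    · exact Or.inl hij
    · exact Or.inr hij
    · exact Or.inr (neg_eq_iff_eq_neg.1 hij)
    · exact Or.inl (neg_injective hij)
  have hwsurj : Set.SurjOn w (Finset.univ : Finset (Fin k)) (oddDirections A) := by
    intro u hu
    have hu' := mem_oddDirections.1 hu
    have hline := (mk'_span_mem_oddBalancedLines_iff (S := S) (x := x) hu'.1).2 (Or.inl hu'.2)
    rw [← hrange] at hline
    obtain ⟨i, hi⟩ := hline
    refine ⟨i, by simp, ?_⟩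
    rcases mk'_span_inj (hv1 i) hu'.1 hi with h1 | h1
    · simp only [w]
      rw [h1, if_pos hu'.2]
    · simp only [w]
      rw [h1, excess_neg, hu'.2, if_neg (by decide), neg_neg]
  refine ⟨hexc, ?_, fun c => ?_⟩
  · have := Finset.card_nbij w hmem hwinj hwsurj
    simpa using this
  · refine (Finset.sum_nbij w hmem hwinj hwsurj fun i _ => ?_).symm
    simp only [w]
    split_ifs with h1
    · rw [h1, one_mul]
    · rw [(hexc i).resolve_left h1, inner_neg_left, Left.sign_neg]
      simp

/-- Finitely many lines in a plane can be listed in rotational order. -/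
theorem exists_isRotationalLabelling {S : Finset (EuclideanSpace ℝ (Fin d))}
    {x : EuclideanSpace ℝ (Fin d)} {P : AffineSubspace ℝ (EuclideanSpace ℝ (Fin d))}
    (hP : Module.finrank ℝ P.direction = 2) (hle : ∀ l ∈ oddBalancedLines S x, l ≤ P) :
    ∃ (k : ℕ) (v : Fin k → EuclideanSpace ℝ (Fin d)), IsRotationalLabelling S x P k v := by
  classical
  obtain ⟨e, heP, f, hfP, he, hf, hef, hspan⟩ := exists_orthonormal_pair P.direction hP
  have hangle : ∀ u ∈ oddDirections (centered S x), ∃ θ : ℝ, 0 ≤ θ ∧ θ < Real.pi ∧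
      (u = Real.cos θ • e + Real.sin θ • f ∨ u = -(Real.cos θ • e + Real.sin θ • f)) := by
    intro u hu
    have hu' := mem_oddDirections.1 hu
    have hl := hle _ ((mk'_span_mem_oddBalancedLines_iff (S := S) (x := x) hu'.1).2
      (Or.inl hu'.2))
    have huP : u ∈ P.direction := by
      refine AffineSubspace.direction_le hl ?_
      rw [AffineSubspace.direction_mk']
      exact Submodule.mem_span_singleton_self u
    obtain ⟨α, β, rfl⟩ := hspan u huP
    have hαβ : α ^ 2 + β ^ 2 = 1 := by
      have h1 : ‖α • e + β • f‖ ^ 2 = 1 := by rw [hu'.1, one_pow]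
      rw [norm_add_sq_real, real_inner_smul_left, real_inner_smul_right, hef, norm_smul, norm_smul,
        he, hf] at h1
      simpa using h1
    obtain ⟨θ, h0, hπ, ⟨rfl, rfl⟩ | ⟨rfl, rfl⟩⟩ := exists_angle hαβ
    · exact ⟨θ, h0, hπ, Or.inl rfl⟩
    · exact ⟨θ, h0, hπ, Or.inr (by simp only [neg_smul, neg_add])⟩
  choose! ang hang0 hangπ hang using hangle
  let Θ := (oddDirections (centered S x)).image ang
  let θ := Θ.orderEmbOfFin rfl
  have hΘ : ∀ i, θ i ∈ Θ := fun i => Finset.orderEmbOfFin_mem _ _ _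
  have hbound : ∀ i, 0 ≤ θ i ∧ θ i < Real.pi := by
    intro i
    obtain ⟨u, hu, h⟩ := Finset.mem_image.1 (hΘ i)
    rw [← h]
    exact ⟨hang0 u hu, hangπ u hu⟩
  have hspanEq : ∀ u ∈ oddDirections (centered S x),
      AffineSubspace.mk' x (Submodule.span ℝ {Real.cos (ang u) • e + Real.sin (ang u) • f}) =
        AffineSubspace.mk' x (Submodule.span ℝ {u}) := by
    intro u hu
    rcases hang u hu with h | h
    · rw [← h]
    · rw [← neg_eq_iff_eq_neg] at h
      rw [← h, mk'_span_neg]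
  refine ⟨Θ.card, fun i => Real.cos (θ i) • e + Real.sin (θ i) • f, ?_, e, heP, f, hfP, he, hf,
    hef, θ, θ.strictMono, fun i j => ?_, fun i => rfl⟩
  · rw [oddBalancedLines_eq_image]
    ext l
    constructor
    · rintro ⟨i, rfl⟩
      obtain ⟨u, hu, h⟩ := Finset.mem_image.1 (hΘ i)
      refine ⟨u, hu, ?_⟩
      simp only [← h]
      exact (hspanEq u hu).symm
    · rintro ⟨u, hu, rfl⟩
      have hmem : ang u ∈ Set.range θ := by
        rw [Finset.range_orderEmbOfFin]
        exact Finset.mem_image_of_mem _ hu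
      obtain ⟨i, hi⟩ := hmem
      refine ⟨i, ?_⟩
      simp only [hi]
      exact hspanEq u hu
  · linarith [(hbound i).1, (hbound j).2]

end Lines

/-! ### Winning points and condition (ii). -/

section Main

variable {d : ℕ}

/-- Labels start at 1 and indices at 0, so odd labels are even indices. -/
theorem extraPointsAlternate_iff {S : Finset (EuclideanSpace ℝ (Fin d))}
    {x : EuclideanSpace ℝ (Fin d)} {k : ℕ} {v : Fin k → EuclideanSpace ℝ (Fin d)} :
    ExtraPointsAlternate S x k v ↔
      (∀ i : Fin k, excess (centered S x) (v i) = 1 ↔ Even (i : ℕ)) ∨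
      (∀ i : Fin k, excess (centered S x) (v i) = 1 ↔ ¬ Even (i : ℕ)) := by
  have h : ∀ u, (rayCount (centered S x) u = rayCount (centered S x) (-u) + 1) ↔
      excess (centered S x) u = 1 := fun u => by
    rw [excess]
    omega
  simp only [ExtraPointsAlternate, countIn_openHalfLine, h, Nat.even_add_one,
    ← Nat.not_even_iff_odd, not_not]

theorem isWinningPoint_iff_abs_signSum_le (S : Finset (EuclideanSpace ℝ (Fin d)))
    (x : EuclideanSpace ℝ (Fin d)) [Decidable (x ∈ S)] :
    IsWinningPoint S x ↔ ∀ c, |signSum (centered S x) c| ≤ if x ∈ S then 1 else 0 := by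
  rw [isWinningPoint_iff, forall_two_mul_card_pos_le_iff]
  simp only [zero_mem_centered]

theorem isWinningPoint_of_balancedLinesCondition {S : Finset (EuclideanSpace ℝ (Fin d))}
    {x : EuclideanSpace ℝ (Fin d)} (h : BalancedLinesCondition S x) : IsWinningPoint S x := by
  classical
  obtain ⟨hbal, P, hP, hle, -, hodd⟩ := h
  rw [forall_isBalancedLine_iff] at hbal
  rw [isWinningPoint_iff_abs_signSum_le]
  intro c
  rw [← signSum_oddDirections hbal]
  rcases (oddBalancedLines S x).eq_empty_or_nonempty with hem | hne
  · rw [oddBalancedLines_eq_image, Set.image_eq_empty, Finset.coe_eq_empty] at hem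
    rw [hem]
    simp only [signSum, Finset.sum_empty, abs_zero]
    split_ifs <;> norm_num
  · obtain ⟨hx, hcard, halt⟩ := hodd hne
    obtain ⟨k, v, hlab⟩ := exists_isRotationalLabelling hP hle
    obtain ⟨hexc, hk, hsum⟩ := hlab.signSum_eq
    rw [ncard_oddBalancedLines, ← hk] at hcard
    have hw : ∃ w₀ : ℤ, |w₀| ≤ 1 ∧
        ∀ i : Fin k, excess (centered S x) (v i) = (-1) ^ (i : ℕ) * w₀ := by
      rcases extraPointsAlternate_iff.1 (halt k v hlab) with h | h
      · refine ⟨1, by norm_num, fun i => ?_⟩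
        rcases Nat.even_or_odd i with hi | hi
        · rw [(h i).2 hi, hi.neg_one_pow, one_mul]
        · rw [(hexc i).resolve_left fun h1 => Nat.not_even_iff_odd.2 hi ((h i).1 h1),
            hi.neg_one_pow, mul_one]
      · refine ⟨-1, by norm_num, fun i => ?_⟩
        rcases Nat.even_or_odd i with hi | hi
        · rw [(hexc i).resolve_left fun h1 => (h i).1 h1 hi, hi.neg_one_pow, one_mul]
        · rw [(h i).2 (Nat.not_even_iff_odd.2 hi), hi.neg_one_pow]
          rfl
    obtain ⟨w₀, hw₀, hw⟩ := hw
    obtain ⟨-, e, -, f, -, -, -, -, θ, hmono, hπ, hv⟩ := hlab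
    -- The odd directions only see `c` through its inner products with `e` and `f`, which serve as
    -- the coefficients of the linear form.
    have := abs_sum_weight_mul_sign_le_one hcard θ hmono hπ _ hw₀ hw ⟪e, c⟫ ⟪f, c⟫
    rw [hsum, if_pos hx]
    convert this using 6 with i
    rw [hv, inner_add_left, real_inner_smul_left, real_inner_smul_left]

theorem balancedLinesCondition_of_isWinningPoint (hd : 2 ≤ d)
    {S : Finset (EuclideanSpace ℝ (Fin d))} (hS : Even S.card)
    {x : EuclideanSpace ℝ (Fin d)} (h : IsWinningPoint S x) : BalancedLinesCondition S x := by
  classical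
  rw [isWinningPoint_iff_abs_signSum_le] at h
  have hA : Even (centered S x).card := by rwa [card_centered]
  have h1 : ∀ c, |signSum (centered S x) c| ≤ 1 := fun c =>
    (h c).trans (by split_ifs <;> norm_num)
  have hbal : ∀ u, u ≠ 0 → |excess (centered S x) u| ≤ 1 := fun u hu => abs_excess_le h1 hu
  obtain ⟨e, f, hef⟩ := exists_forall_mem_span_pair_of_abs_signSum_le_one
    (U := oddDirections (centered S x)) (fun u hu => (mem_oddDirections.1 hu).1)
    (fun u hu => neg_notMem_oddDirections hu)
    (fun c => by rw [signSum_oddDirections hbal]; exact h1 c)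
  obtain ⟨Q, hQ2, hQ⟩ := exists_plane (E := EuclideanSpace ℝ (Fin d))
    (by rwa [finrank_euclideanSpace_fin]) e f
  refine ⟨forall_isBalancedLine_iff.2 hbal, AffineSubspace.mk' x Q, ?_, ?_, ?_, ?_⟩
  · rwa [AffineSubspace.direction_mk']
  · rw [oddBalancedLines_eq_image]
    rintro _ ⟨u, hu, rfl⟩ y hy
    rw [AffineSubspace.mem_mk'] at hy ⊢
    exact (Submodule.span_singleton_le_iff_mem _ _).2 (hQ (hef u hu)) hy
  · intro hem
    rw [oddBalancedLines_eq_image, Set.image_eq_empty, Finset.coe_eq_empty] at hem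
    rw [← zero_mem_centered]
    exact zero_notMem_of_oddDirections_eq_empty hA hbal hem
  · intro hne
    -- For `x ∉ S` the sign sums vanish on every line as well, whereas an odd direction has excess
    -- 1.
    have hx : x ∈ S := by
      by_contra hx
      simp only [if_neg hx] at h
      rw [oddBalancedLines_eq_image] at hne
      obtain ⟨_, u, hu, rfl⟩ := hne
      have hu' := mem_oddDirections.1 hu
      have := abs_excess_le h (v := u) (by rintro rfl; simp at hu')
      rw [hu'.2] at this
      norm_num at this
    have hodd := odd_card_oddDirections hA (zero_mem_centered.2 hx) hbal
    refine ⟨hx, by rwa [ncard_oddBalancedLines], fun k v hlab => ?_⟩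
    obtain ⟨hexc, hk, hsum⟩ := hlab.signSum_eq
    rw [← hk] at hodd
    obtain ⟨-, e, -, f, -, he, hf, hef, θ, hmono, hπ, hv⟩ := hlab
    have hfe : ⟪f, e⟫ = 0 := by rw [real_inner_comm, hef]
    have hw := weight_eq_of_abs_sum_le_one hodd θ hmono hπ _ hexc (fun α β => by
      have hb := h1 (α • e + β • f)
      rw [← signSum_oddDirections hbal, hsum] at hb
      convert hb using 6 with i
      rw [inner_add_right, real_inner_smul_right, real_inner_smul_right, hv,
        (inner_cos_smul_add_sin_smul he hf hef _).1, (inner_cos_smul_add_sin_smul he hf hef _).2]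
      ring)
    rw [extraPointsAlternate_iff]
    rcases hexc ⟨0, hodd.pos⟩ with h0 | h0 <;> rw [h0] at hw
    · left
      intro i
      rw [hw]
      rcases Nat.even_or_odd i with hi | hi
      · simp [hi]
      · simp [hi.neg_one_pow, Nat.not_even_iff_odd.2 hi]
    · right
      intro i
      rw [hw]
      rcases Nat.even_or_odd i with hi | hi
      · simp [hi]
      · simp [hi.neg_one_pow, Nat.not_even_iff_odd.2 hi]

end Main

theorem theorem3 (d : ℕ) (hd : 2 ≤ d) (S : Finset (EuclideanSpace ℝ (Fin d)))
    (hS : Even S.card) :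
    (AliceWins S ↔ ∃ x : EuclideanSpace ℝ (Fin d), PerfectHyperplanesContain S x) ∧
    (AliceWins S ↔ ∃ x : EuclideanSpace ℝ (Fin d), BalancedLinesCondition S x) ∧
    (∀ x : EuclideanSpace ℝ (Fin d), BalancedLinesCondition S x →
      PerfectHyperplanesContain S x ∧ IsWinningPoint S x) ∧
    (¬ Collinear ℝ (S : Set (EuclideanSpace ℝ (Fin d))) →
      ∀ x : EuclideanSpace ℝ (Fin d),
        (PerfectHyperplanesContain S x ↔ BalancedLinesCondition S x) ∧
        (PerfectHyperplanesContain S x → IsWinningPoint S x)) := by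
  refine ⟨⟨?_, ?_⟩, ⟨?_, ?_⟩, ?_, ?_⟩
  · rintro ⟨x, hx⟩
    exact ⟨x, perfectHyperplanesContain_of_isWinningPoint hx⟩
  · rintro ⟨x, hx⟩
    -- In the collinear case `x` itself need not win: for two voters every point of their line
    -- satisfies (i), even outside the segment.
    by_cases hcol : Collinear ℝ (S : Set (EuclideanSpace ℝ (Fin d)))
    · exact exists_isWinningPoint_of_collinear hcol
    · exact ⟨x, isWinningPoint_of_perfectHyperplanesContain hS hcol hx⟩
  · rintro ⟨x, hx⟩
    exact ⟨x, balancedLinesCondition_of_isWinningPoint hd hS hx⟩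
  · rintro ⟨x, hx⟩
    exact ⟨x, isWinningPoint_of_balancedLinesCondition hx⟩
  · intro x hx
    have hwin := isWinningPoint_of_balancedLinesCondition hx
    exact ⟨perfectHyperplanesContain_of_isWinningPoint hwin, hwin⟩
  · intro hcol x
    have hwin : PerfectHyperplanesContain S x → IsWinningPoint S x :=
      isWinningPoint_of_perfectHyperplanesContain hS hcol
    exact ⟨⟨fun hx => balancedLinesCondition_of_isWinningPoint hd hS (hwin hx), fun hx =>
      perfectHyperplanesContain_of_isWinningPoint (isWinningPoint_of_balancedLinesCondition hx)⟩,
      hwin⟩
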